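/- Let $k$ be a field and let $C, D$ be small dg categories over $k$ (cohomological grading). An $A_\infty$-functor $C\to D$ means a strictly unital one: a map on objects together with multilinear components $F_n\colon C(X_{n-1},X_n)\otimes\cdots\otimes C(X_0,X_1)\to D(FX_0,FX_n)$ of degree $1-n$ ($n\ge 1$) that satisfy the $A_\infty$-functor equations, with $F_1(\mathrm{id}_X)=\mathrm{id}_{FX}$ and $F_n(\dots,\mathrm{id},\dots)=0$ for $n\ge 2$. Dg functors are the $A_\infty$-functors with $F_n=0$ for $n\ge2$. Let $\mathrm{Coh}_{A_\infty}(C,D)$ be the dg category whose objects are the $A_\infty$-functors $C\to D$ and whose complex of morphisms from $F$ to $G$ is the complex of coherent natural transformations: its degree $p$ part consists of the families $$\Psi=(\Psi_n)_{n\ge 0}\in \prod_{n\ge0}\ \prod_{X_0,\dots,X_n}\mathrm{Hom}_k^{\,p-n}\big(C(X_{n-1},X_n)\otimes\cdots\otimes C(X_0,X_1),\,D(FX_0,GX_n)\big)$$ that vanish as soon as one argument is an identity morphism, with the (normalized) Hochschild differential twisted by $F$ and $G$, and with the cup product as composition. If $F,G$ are dg functors, this is the normalized Hochschild cochain complex of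 $C$ with coefficients in the bimodule $D(F-,G-)$. Let $\mathrm{Coh}_{\mathrm{dg}}(C,D)$ be the dg category whose objects are the dg functors $C\to D$, with the same complexes of morphisms, and let $i\colon \mathrm{Coh}_{\mathrm{dg}}(C,D)\to\mathrm{Coh}_{A_\infty}(C,D)$ be the natural embedding. Suppose that $C$ is cofibrant for the Tabuada model structure, that is, the dg functor $\varnothing\to C$ has the left lifting property with respect to every dg functor $p\colon A\to B$ between small dg categories that is both a quasi-equivalence and a fibration (degreewise surjective on all complexes of morphisms, and such that every isomorphism $H^0(p)(x)\to y'$ in $H^0(B)$ is the image under $H^0(p)$ of an isomorphism $x\to y$ in $H^0(A)$). Then $i$ is a quasi-equivalence: it induces quasi-isomorphisms on all complexes of morphisms, and $H^0(i)$ is an equivalence of categories. -/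

import Mathlib

open CategoryTheory

universe u

/-- The sign `(-1)^n` as an element of `k`. -/
def koszulSign (k : Type u) [Field k] (n : ℤ) : k := ((n.negOnePow : ℤ) : k)

/-- A small dg category over `k`, cohomologically graded. `Hom X Y n` is the degree `n` part of the
complex of morphisms `X ⟶ Y`, and `comp h g f` is the composition `g ∘ f`. -/
structure DGCat (k : Type u) [Field k] where
  Obj : Type u
  Hom : Obj → Obj → ℤ → Type u
  [addCommGroupHom : ∀ X Y n, AddCommGroup (Hom X Y n)]
  [moduleHom : ∀ X Y n, Module k (Hom X Y n)]
  d : ∀ {X Y : Obj} (n m : ℤ), n + 1 = m → (Hom X Y n →ₗ[k] Hom X Y m)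
  one : ∀ X : Obj, Hom X X 0
  comp : ∀ {X Y Z : Obj} {p q r : ℤ}, p + q = r →
    (Hom Y Z p →ₗ[k] Hom X Y q →ₗ[k] Hom X Z r)
  d_d : ∀ {X Y : Obj} {n m l : ℤ} (h : n + 1 = m) (h' : m + 1 = l) (f : Hom X Y n),
    d m l h' (d n m h f) = 0
  one_comp : ∀ {X Y : Obj} {p : ℤ} (f : Hom X Y p), comp (zero_add p) (one Y) f = f
  comp_one : ∀ {X Y : Obj} {p : ℤ} (f : Hom X Y p), comp (add_zero p) f (one X) = f
  assoc : ∀ {W X Y Z : Obj} {p q r a b s : ℤ} (h₁ : p + q = a) (h₂ : a + r = s)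
    (h₃ : q + r = b) (h₄ : p + b = s) (x : Hom Y Z p) (y : Hom X Y q) (z : Hom W X r),
    comp h₂ (comp h₁ x y) z = comp h₄ x (comp h₃ y z)
  leibniz : ∀ {X Y Z : Obj} {p q r p' q' r' : ℤ} (h : p + q = r) (hp : p + 1 = p')
    (hq : q + 1 = q') (hr : r + 1 = r') (h₁ : p' + q = r') (h₂ : p + q' = r')
    (g : Hom Y Z p) (f : Hom X Y q),
    d r r' hr (comp h g f) =
      comp h₁ (d p p' hp g) f + koszulSign k p • comp h₂ g (d q q' hq f)

attribute [instance] DGCat.addCommGroupHom DGCat.moduleHom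

section Sign

variable (k : Type u) [Field k]

theorem koszulSign_add (a b : ℤ) : koszulSign k (a + b) = koszulSign k a * koszulSign k b := by
  simp [koszulSign, Int.negOnePow_add]

theorem koszulSign_sub (a b : ℤ) : koszulSign k (a - b) = koszulSign k a * koszulSign k b := by
  simp [koszulSign, Int.negOnePow_sub]

theorem koszulSign_zero : koszulSign k 0 = 1 := by simp [koszulSign]

theorem koszulSign_one : koszulSign k 1 = -1 := by simp [koszulSign]

theorem koszulSign_cases (a : ℤ) : koszulSign k a = 1 ∨ koszulSign k a = -1 := by
  rcases Int.even_or_odd a with h | h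
  · left; simp [koszulSign, Int.negOnePow_even a h]
  · right; simp [koszulSign, Int.negOnePow_odd a h]

theorem koszulSign_mul_self (a : ℤ) : koszulSign k a * koszulSign k a = 1 := by
  rcases koszulSign_cases k a with h | h <;> simp [h]

end Sign

namespace DGCat

variable {k : Type u} [Field k]

theorem d_one (C : DGCat k) (X : C.Obj) {m : ℤ} (h : 0 + 1 = m) :
    C.d 0 m h (C.one X) = 0 := by
  subst h
  have h := C.leibniz (zero_add 0) rfl rfl rfl (add_zero (0 + 1)) (zero_add (0 + 1))
    (C.one X) (C.one X)
  rw [C.one_comp, C.comp_one, C.one_comp, koszulSign_zero, one_smul] at h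
  simpa using h

/-- Chains of composable homogeneous morphisms of `C`; the last applied morphism comes first,
so that `cons fₙ (… (cons f₁ nil))` stands for the element `[fₙ|…|f₁]` of the bar construction. -/
inductive Chain (C : DGCat k) (X : C.Obj) : C.Obj → Type u
  | nil : Chain C X X
  | cons {Y Z : C.Obj} {n : ℤ} (f : C.Hom Y Z n) (c : Chain C X Y) : Chain C X Z

namespace Chain

variable {C : DGCat k}

/-- The degree `∑ (|fᵢ| - 1)` of `[fₙ|…|f₁]` in the bar construction. -/
def deg {X : C.Obj} : ∀ {Y : C.Obj}, Chain C X Y → ℤ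
  | _, nil => 0
  | _, cons (n := n) _ c => (n - 1) + deg c

/-- The number of morphisms in a chain. -/
def length {X : C.Obj} : ∀ {Y : C.Obj}, Chain C X Y → ℕ
  | _, nil => 0
  | _, cons _ c => length c + 1

/-- Concatenation, `[fₙ|…|fₘ₊₁] ++ [fₘ|…|f₁]`. -/
def append {X Y : C.Obj} : ∀ {Z : C.Obj}, Chain C Y Z → Chain C X Y → Chain C X Z
  | _, nil, u => u
  | _, cons f v, u => cons f (append v u)

variable {M : Type u} [AddCommGroup M] [Module k M]

/-- The part `[g|f|…] ↦ (-1)^|g| [gf|…]` of the bar differential that composes `g` with the next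
morphism. -/
def merge {X Y Z : C.Obj} {n : ℤ} (g : C.Hom Y Z n) :
    Chain C X Y → (Chain C X Z → M) → M
  | nil, _ => 0
  | cons f c, K => koszulSign k n • K (cons (C.comp rfl g f) c)

/-- `bar c K` is the value at `b(c)` of the linear extension of `K`, where `b` is the differential
of the bar construction: the coderivation with `b[f] = -[df]`, `b[g|f] = (-1)^|g| [gf] + …`. -/
def bar {X : C.Obj} : ∀ {Y : C.Obj}, Chain C X Y → (Chain C X Y → M) → M
  | _, nil, _ => 0
  | _, cons (n := n) g c, K =>
    -K (cons (C.d n (n + 1) rfl g) c) + merge g c K +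
      koszulSign k (n - 1) • bar c (fun c' => K (cons g c'))

/-- `splits c K` is the sum of `K v u` over all decompositions `c = v ++ u`
(the deconcatenation coproduct). -/
def splits {X : C.Obj} : ∀ {Y : C.Obj} (_ : Chain C X Y)
    (_ : ∀ ⦃W : C.Obj⦄, Chain C W Y → Chain C X W → M), M
  | _, nil, K => K nil nil
  | _, cons g c, K => K nil (cons g c) + splits c (fun _ v u => K (cons g v) u)

/-- `K` is linear in each entry of the chain. -/
def IsMultilinear {X Y : C.Obj} (K : Chain C X Y → M) : Prop :=
  ∀ ⦃W Z : C.Obj⦄ ⦃n : ℤ⦄ (v : Chain C Z Y) (u : Chain C X W) (a : k) (f f' : C.Hom W Z n),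
    K (v.append (cons (a • f + f') u)) = a • K (v.append (cons f u)) + K (v.append (cons f' u))

/-- `K` vanishes on the chains one of whose entries is an identity. -/
def IsNormalized {X Y : C.Obj} (K : Chain C X Y → M) : Prop :=
  ∀ ⦃W : C.Obj⦄ (v : Chain C W Y) (u : Chain C X W), K (v.append (cons (C.one W) u)) = 0

theorem deg_nil {X : C.Obj} : (nil : Chain C X X).deg = 0 := rfl

theorem deg_cons {X Y Z : C.Obj} {n : ℤ} (g : C.Hom Y Z n) (c : Chain C X Y) :
    (cons g c).deg = n - 1 + c.deg := rfl

theorem bar_nil {X : C.Obj} (K : Chain C X X → M) : bar nil K = 0 := rfl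

theorem bar_cons {X Y Z : C.Obj} {n : ℤ} (g : C.Hom Y Z n) (c : Chain C X Y)
    (K : Chain C X Z → M) :
    bar (cons g c) K = -K (cons (C.d n (n + 1) rfl g) c) + merge g c K +
      koszulSign k (n - 1) • bar c (fun c' => K (cons g c')) := rfl

theorem merge_nil {X Z : C.Obj} {n : ℤ} (g : C.Hom X Z n) (K : Chain C X Z → M) :
    merge g nil K = 0 := rfl

theorem merge_cons {X Y Z W : C.Obj} {n m : ℤ} (g : C.Hom Z W n) (f : C.Hom Y Z m)
    (c : Chain C X Y) (K : Chain C X W → M) :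
    merge g (cons f c) K = koszulSign k n • K (cons (C.comp rfl g f) c) := rfl

theorem splits_nil {X : C.Obj} (K : ∀ ⦃W : C.Obj⦄, Chain C W X → Chain C X W → M) :
    splits nil K = K nil nil := rfl

theorem splits_cons {X Y Z : C.Obj} {n : ℤ} (g : C.Hom Y Z n) (c : Chain C X Y)
    (K : ∀ ⦃W : C.Obj⦄, Chain C W Z → Chain C X W → M) :
    splits (cons g c) K = K nil (cons g c) + splits c (fun _ v u => K (cons g v) u) := rfl

variable {N : Type u} [AddCommGroup N] [Module k N]

theorem map_merge (L : M →ₗ[k] N) {X Y Z : C.Obj} {n : ℤ} (g : C.Hom Y Z n) (c : Chain C X Y)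
    (K : Chain C X Z → M) : L (merge g c K) = merge g c (fun c' => L (K c')) := by
  cases c <;> simp [merge_nil, merge_cons]

theorem map_bar (L : M →ₗ[k] N) {X Y : C.Obj} (c : Chain C X Y) (K : Chain C X Y → M) :
    L (bar c K) = bar c (fun c' => L (K c')) := by
  induction c with
  | nil => simp [bar_nil]
  | cons g c ih => simp [bar_cons, map_merge, ih]

theorem map_splits (L : M →ₗ[k] N) {X Y : C.Obj} (c : Chain C X Y)
    (K : ∀ ⦃W : C.Obj⦄, Chain C W Y → Chain C X W → M) :
    L (splits c K) = splits c (fun _ v u => L (K v u)) := by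
  induction c with
  | nil => simp [splits]
  | cons g c ih => simp [splits, ih]

theorem merge_add {X Y Z : C.Obj} {n : ℤ} (g : C.Hom Y Z n) (c : Chain C X Y)
    (K K' : Chain C X Z → M) :
    merge g c (fun c' => K c' + K' c') = merge g c K + merge g c K' := by
  cases c <;> simp [merge_nil, merge_cons]

theorem bar_add {X Y : C.Obj} (c : Chain C X Y) (K K' : Chain C X Y → M) :
    bar c (fun c' => K c' + K' c') = bar c K + bar c K' := by
  induction c with
  | nil => simp [bar_nil]
  | cons g c ih => simp only [bar_cons, merge_add, ih]; module

theorem bar_smul {X Y : C.Obj} (c : Chain C X Y) (a : k) (K : Chain C X Y → M) :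
    bar c (fun c' => a • K c') = a • bar c K :=
  (map_bar (a • LinearMap.id) c K).symm

theorem bar_neg {X Y : C.Obj} (c : Chain C X Y) (K : Chain C X Y → M) :
    bar c (fun c' => -K c') = -bar c K :=
  (map_bar (-LinearMap.id : M →ₗ[k] M) c K).symm

theorem bar_zero {X Y : C.Obj} (c : Chain C X Y) : bar c (fun _ => (0 : M)) = 0 := by
  simpa using bar_smul c (0 : k) (fun _ => (0 : M))

theorem splits_add {X Y : C.Obj} (c : Chain C X Y)
    (K K' : ∀ ⦃W : C.Obj⦄, Chain C W Y → Chain C X W → M) :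
    splits c (fun _ v u => K v u + K' v u) = splits c K + splits c K' := by
  induction c with
  | nil => simp [splits]
  | cons g c ih => simp [splits, ih]; abel

theorem splits_smul {X Y : C.Obj} (c : Chain C X Y) (a : k)
    (K : ∀ ⦃W : C.Obj⦄, Chain C W Y → Chain C X W → M) :
    splits c (fun _ v u => a • K v u) = a • splits c K :=
  (map_splits (a • LinearMap.id) c K).symm

theorem bar_congr {X Y : C.Obj} (c : Chain C X Y) {K K' : Chain C X Y → M}
    (h : ∀ c' : Chain C X Y, c'.deg = c.deg + 1 → K c' = K' c') : bar c K = bar c K' := by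
  induction c with
  | nil => rfl
  | cons g c ih =>
    rw [bar_cons, bar_cons, ih fun c' hc => h (cons g c') (by simp only [deg, hc]; ring),
      h _ (by simp only [deg]; ring)]
    cases c with
    | nil => rfl
    | cons f c => rw [merge_cons, merge_cons, h _ (by simp only [deg]; ring)]

theorem splits_congr {X Y : C.Obj} (c : Chain C X Y)
    {K K' : ∀ ⦃W : C.Obj⦄, Chain C W Y → Chain C X W → M}
    (h : ∀ ⦃W : C.Obj⦄ (v : Chain C W Y) (u : Chain C X W), v.deg + u.deg = c.deg →
      K v u = K' v u) : splits c K = splits c K' := by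
  induction c with
  | nil => exact h _ _ (by simp [deg])
  | cons g c ih =>
    simp only [splits]
    rw [h _ _ (by simp [deg]), ih fun W v u hvu => h _ _ (by simp [deg, ← hvu]; ring)]

theorem bar_eq_zero {X Y : C.Obj} (c : Chain C X Y) {K : Chain C X Y → M}
    (h : ∀ c' : Chain C X Y, c'.deg = c.deg + 1 → K c' = 0) : bar c K = 0 := by
  rw [bar_congr c (K' := fun _ => (0 : k) • (0 : M)) (by simpa using h), bar_smul, zero_smul]

theorem splits_eq_zero {X Y : C.Obj} (c : Chain C X Y)
    {K : ∀ ⦃W : C.Obj⦄, Chain C W Y → Chain C X W → M}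
    (h : ∀ ⦃W : C.Obj⦄ (v : Chain C W Y) (u : Chain C X W), v.deg + u.deg = c.deg →
      K v u = 0) : splits c K = 0 := by
  rw [splits_congr c (K' := fun _ _ _ => (0 : k) • (0 : M)) (by simpa using h), splits_smul,
    zero_smul]

theorem cons_comp {X Y Z W : C.Obj} {p q r r' : ℤ} (h : p + q = r) (h' : p + q = r')
    (g : C.Hom Z W p) (f : C.Hom Y Z q) (c : Chain C X Y) :
    cons (C.comp h g f) c = cons (C.comp h' g f) c := by
  subst h; subst h'; rfl

theorem IsMultilinear.cons {X Y Z : C.Obj} {n : ℤ} {K : Chain C X Z → M} (h : IsMultilinear K)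
    (g : C.Hom Y Z n) : IsMultilinear (fun c => K (cons g c)) :=
  fun _ _ _ v u => h (Chain.cons g v) u

theorem IsNormalized.cons {X Y Z : C.Obj} {n : ℤ} {K : Chain C X Z → M} (h : IsNormalized K)
    (g : C.Hom Y Z n) : IsNormalized (fun c => K (cons g c)) :=
  fun _ v u => h (Chain.cons g v) u

theorem IsNormalized.head {X Y : C.Obj} {K : Chain C X Y → M} (h : IsNormalized K)
    (c : Chain C X Y) : K (Chain.cons (C.one Y) c) = 0 := h nil c

theorem IsNormalized.tail {W X Y Z : C.Obj} {n : ℤ} {K : Chain C X Z → M} (h : IsNormalized K)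
    (g : C.Hom Y Z n) (v : Chain C W Y) (u : Chain C X W) :
    K (Chain.cons g (v.append (Chain.cons (C.one W) u))) = 0 := h (Chain.cons g v) u

theorem IsMultilinear.lin {X Y Z : C.Obj} {n : ℤ} {K : Chain C X Z → M} (h : IsMultilinear K)
    (a : k) (f f' : C.Hom Y Z n) (c : Chain C X Y) :
    K (Chain.cons (a • f + f') c) = a • K (Chain.cons f c) + K (Chain.cons f' c) :=
  h nil c a f f'

theorem IsMultilinear.zero {X Y Z : C.Obj} (n : ℤ) {K : Chain C X Z → M} (h : IsMultilinear K)
    (c : Chain C X Y) : K (Chain.cons (0 : C.Hom Y Z n) c) = 0 := by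
  have := h.lin 1 (0 : C.Hom Y Z n) 0 c
  simpa using this

theorem merge_bar {X Y Z : C.Obj} {n : ℤ} (g : C.Hom Y Z n) (c : Chain C X Y)
    (K : Chain C X Z → M) (hK : IsMultilinear K) :
    merge g c (fun c' => bar c' K) - merge (C.d n (n + 1) rfl g) c K +
      koszulSign k (n - 1) • bar c (fun c' => merge g c' K) = 0 := by
  cases c with
  | nil => simp [merge_nil, bar_nil]
  | cons f c =>
    rename_i Y m
    have hd : K (cons (C.d (n + m) (n + m + 1) rfl (C.comp rfl g f)) c) =
        K (cons (C.comp rfl (C.d n (n + 1) rfl g) f) c) +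
          koszulSign k n • K (cons (C.comp rfl g (C.d m (m + 1) rfl f)) c) := by
      have e₁ : n + 1 + m = n + m + 1 := by ring
      have e₂ : n + (m + 1) = n + m + 1 := by ring
      rw [C.leibniz rfl rfl rfl rfl e₁ e₂, add_comm (C.comp e₁ _ _), hK.lin, cons_comp e₂ rfl,
        cons_comp e₁ rfl]
      exact add_comm _ _
    have hm : merge f c (fun c' => merge g c' K) =
        merge (C.comp rfl g f) c K := by
      cases c with
      | nil => simp [merge_nil]
      | cons e c =>
        rw [merge_cons, merge_cons, merge_cons, C.assoc rfl rfl rfl (add_assoc _ _ _).symm,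
          cons_comp (add_assoc _ _ _).symm rfl, koszulSign_add]
        module
    have hb : bar c (fun c' => merge g (cons f c') K) =
        koszulSign k n • bar c (fun c' => K (cons (C.comp rfl g f) c')) := by
      simp only [merge_cons, bar_smul]
    rw [merge_cons, bar_cons, hd, merge_cons, bar_cons, hm, hb, merge_cons]
    simp only [koszulSign_add, koszulSign_sub, koszulSign_one]
    rcases koszulSign_cases k n with h | h <;> rw [h] <;> module

theorem bar_bar {X Y : C.Obj} (c : Chain C X Y) (K : Chain C X Y → M) (hK : IsMultilinear K) :
    bar c (fun c' => bar c' K) = 0 := by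
  induction c with
  | nil => rfl
  | cons g c ih =>
    rename_i Y Z n
    have h0 := ih (fun c' => K (cons g c')) (hK.cons g)
    have h1 := merge_bar g c K hK
    simp only [bar_cons, C.d_d, hK.zero, bar_add, bar_smul, bar_neg, h0]
    simp only [koszulSign_add, koszulSign_sub, koszulSign_one] at h1 ⊢
    refine Eq.trans ?_ h1
    rcases koszulSign_cases k n with h | h <;> rw [h] <;> module

theorem merge_splits {X Y Z : C.Obj} {n : ℤ} (g : C.Hom Y Z n) (c : Chain C X Y)
    (K : ∀ ⦃W : C.Obj⦄, Chain C W Z → Chain C X W → M) :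
    merge g c (fun c' => splits c' K) = merge g c (fun c' => K nil c') +
      splits c (fun _ v u => merge g v (fun v' => K v' u)) := by
  cases c with
  | nil => simp [merge_nil, splits_nil]
  | cons f c => simp [merge_nil, merge_cons, splits_cons, splits_smul]

theorem bar_splits {X Y : C.Obj} (c : Chain C X Y)
    (K : ∀ ⦃W : C.Obj⦄, Chain C W Y → Chain C X W → M) :
    bar c (fun c' => splits c' K) = splits c (fun _ v u =>
      bar v (fun v' => K v' u) + koszulSign k v.deg • bar u (fun u' => K v u')) := by
  induction c with
  | nil => simp [bar_nil, splits_nil]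
  | cons g c ih =>
    rename_i Y Z n
    simp only [bar_cons, splits_cons, merge_splits, bar_add, ih, bar_nil, deg, koszulSign_add,
      koszulSign_zero, splits_add, mul_smul, splits_smul, zero_add, one_smul]
    have : splits c (fun W v u => -K (cons (C.d n (n + 1) rfl g) v) u) =
        -splits c (fun W v u => K (cons (C.d n (n + 1) rfl g) v) u) := by
      simpa using splits_smul c (-1 : k) (fun W v u => K (cons (C.d n (n + 1) rfl g) v) u)
    rw [this]
    module

theorem splits_assoc {X Y : C.Obj} (c : Chain C X Y)
    (K : ∀ ⦃V W : C.Obj⦄, Chain C W Y → Chain C V W → Chain C X V → M) :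
    splits c (fun _ v u => splits v (fun _ v₁ v₂ => K v₁ v₂ u)) =
      splits c (fun _ v u => splits u (fun _ u₁ u₂ => K v u₁ u₂)) := by
  induction c with
  | nil => rfl
  | cons g c ih =>
    simp only [splits_cons, splits_nil, splits_add, ih fun _ _ v₁ v₂ u => K (cons g v₁) v₂ u,
      add_assoc]

theorem splits_eq_left {X Y : C.Obj} (c : Chain C X Y)
    {K : ∀ ⦃W : C.Obj⦄, Chain C W Y → Chain C X W → M}
    (h : ∀ {W V : C.Obj} {n : ℤ} (v : Chain C V Y) (f : C.Hom W V n) (u : Chain C X W),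
      K v (cons f u) = 0) : splits c K = K c nil := by
  induction c with
  | nil => rfl
  | cons g c ih => rw [splits_cons, h, zero_add, ih]; intros; apply h

theorem splits_eq_right {X Y : C.Obj} (c : Chain C X Y)
    {K : ∀ ⦃W : C.Obj⦄, Chain C W Y → Chain C X W → M}
    (h : ∀ {W V : C.Obj} {n : ℤ} (f : C.Hom V Y n) (v : Chain C W V) (u : Chain C X W),
      K (cons f v) u = 0) : splits c K = K nil c := by
  cases c with
  | nil => rfl
  | cons g c => rw [splits_cons, splits_eq_zero c fun _ _ _ _ => h _ _ _, add_zero]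

theorem IsMultilinear.bar {X Y : C.Obj} {K : Chain C X Y → M} (h : IsMultilinear K) :
    IsMultilinear (fun c => bar c K) := by
  intro W Z n v u a f f'
  induction v with
  | nil =>
    simp only [append, bar_cons, map_add, map_smul, h.lin, bar_add, bar_smul]
    have hm : merge (a • f + f') u K = a • merge f u K + merge f' u K := by
      cases u with
      | nil => simp [merge_nil]
      | cons e u =>
        simp only [merge_cons, map_add, map_smul, LinearMap.add_apply, LinearMap.smul_apply,
          h.lin]
        module
    rw [hm]
    module
  | cons g v ih =>
    rename_i Y V m
    simp only [append, bar_cons]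
    have hm : merge g (v.append (Chain.cons (a • f + f') u)) K =
        a • merge g (v.append (Chain.cons f u)) K + merge g (v.append (Chain.cons f' u)) K := by
      cases v with
      | nil =>
        simp only [append, merge_cons, map_add, map_smul, h.lin]
        module
      | cons e v =>
        simp only [append, merge_cons]
        have := h (Chain.cons (C.comp rfl g e) v) u a f f'
        simp only [append] at this
        rw [this]
        module
    have h1 := h (Chain.cons (C.d m (m + 1) rfl g) v) u a f f'
    simp only [append] at h1
    have h2 := ih (h.cons g)
    simp only at h2
    rw [h1, h2, hm]
    module

theorem deg_append {X Y Z : C.Obj} (v : Chain C Y Z) (u : Chain C X Y) :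
    (v.append u).deg = v.deg + u.deg := by
  induction v with
  | nil => simp [append, deg]
  | cons g v ih => simp [append, deg, ih, add_assoc]


theorem isMultilinear_splits {X Y : C.Obj}
    {K : ∀ ⦃W : C.Obj⦄, Chain C W Y → Chain C X W → M}
    (h₁ : ∀ ⦃W : C.Obj⦄ (u : Chain C X W), IsMultilinear (fun v : Chain C W Y => K v u))
    (h₂ : ∀ ⦃W : C.Obj⦄ (v : Chain C W Y), IsMultilinear (K v)) :
    IsMultilinear (fun c => splits c K) := by
  intro W Z n v u a f f'
  induction v with
  | nil =>
    have h : splits u (fun W v u => K (Chain.cons (a • f + f') v) u) =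
        a • splits u (fun W v u => K (Chain.cons f v) u) +
          splits u (fun W v u => K (Chain.cons f' v) u) := by
      rw [← splits_smul, ← splits_add]
      exact splits_congr _ fun W v u _ => (h₁ u).lin a f f' v
    simp only [append, splits_cons, (h₂ _).lin, h]
    module
  | cons g v ih =>
    have h := h₂ nil (Chain.cons g v) u a f f'
    simp only [append] at h
    have h' := ih (fun W u => (h₁ u).cons g) (fun W v => h₂ (Chain.cons g v))
    dsimp only at h'
    simp only [append, splits_cons, h, h']
    module

theorem isNormalized_splits {X Y : C.Obj}
    {K : ∀ ⦃W : C.Obj⦄, Chain C W Y → Chain C X W → M}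
    (h₁ : ∀ ⦃W : C.Obj⦄ (u : Chain C X W), IsNormalized (fun v : Chain C W Y => K v u))
    (h₂ : ∀ ⦃W : C.Obj⦄ (v : Chain C W Y), IsNormalized (K v)) :
    IsNormalized (fun c => splits c K) := by
  intro W v u
  induction v with
  | nil =>
    simp only [append, splits_cons]
    rw [(h₂ nil).head, splits_eq_zero u fun V v u _ => (h₁ u).head v, add_zero]
  | cons g v ih =>
    have h' := ih (fun W u => (h₁ u).cons g) (fun W v => h₂ (Chain.cons g v))
    dsimp only at h'
    simp only [append, splits_cons]
    rw [h', (h₂ nil).tail, add_zero]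

theorem bar_one {X Y : C.Obj} {K : Chain C X Y → M} (hm : IsMultilinear K)
    (hn : IsNormalized K) (u : Chain C X Y) (hu : u.length ≠ 0) :
    bar (Chain.cons (C.one Y) u) K = K u := by
  rw [bar_cons, C.d_one, hm.zero, bar_eq_zero u fun c' _ => hn.head c']
  cases u with
  | nil => exact absurd rfl hu
  | cons f u => rw [merge_cons, cons_comp _ (zero_add _), C.one_comp, koszulSign_zero]; simp

theorem bar_one_nil {X : C.Obj} {K : Chain C X X → M} (hm : IsMultilinear K) :
    bar (Chain.cons (C.one X) nil) K = 0 := by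
  rw [bar_cons, C.d_one, hm.zero, merge_nil, bar_nil]; simp

theorem bar_append_one_nil {X Y : C.Obj} {K : Chain C X Y → M} (hm : IsMultilinear K)
    (hn : IsNormalized K) (v : Chain C X Y) (hv : v.length ≠ 0) :
    bar (v.append (Chain.cons (C.one X) nil)) K = -(koszulSign k v.deg • K v) := by
  induction v with
  | nil => exact absurd rfl hv
  | cons g v ih =>
    rename_i Y Z n
    have h1 := hn (Chain.cons (C.d n (n + 1) rfl g) v) nil
    simp only [append] at h1 ⊢
    rw [bar_cons, h1]
    cases v with
    | nil =>
      simp only [append, merge_cons, bar_one_nil (hm.cons g), deg]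
      rw [cons_comp _ (add_zero _), C.comp_one, add_zero, koszulSign_sub, koszulSign_one]
      module
    | cons e v =>
      have h2 := hn (Chain.cons (C.comp rfl g e) v) nil
      simp only [append] at h2
      rw [ih (hm.cons g) (hn.cons g) (by simp [length])]
      simp only [append, merge_cons, h2]
      rw [deg_cons g, koszulSign_add]
      module

theorem bar_append_one {W X Y : C.Obj} {K : Chain C X Y → M} (hm : IsMultilinear K)
    (hn : IsNormalized K) (v : Chain C W Y) (u : Chain C X W) (hv : v.length ≠ 0)
    (hu : u.length ≠ 0) : bar (v.append (Chain.cons (C.one W) u)) K = 0 := by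
  induction v with
  | nil => exact absurd rfl hv
  | cons g v ih =>
    rename_i Y Z n
    have h1 := hn (Chain.cons (C.d n (n + 1) rfl g) v) u
    simp only [append] at h1 ⊢
    rw [bar_cons, h1]
    cases v with
    | nil =>
      simp only [append, merge_cons]
      rw [bar_one (hm.cons g) (hn.cons g) u hu, cons_comp _ (add_zero _), C.comp_one,
        koszulSign_sub, koszulSign_one]
      module
    | cons e v =>
      have h2 := hn (Chain.cons (C.comp rfl g e) v) u
      simp only [append] at h2
      rw [ih (hm.cons g) (hn.cons g) (by simp [length])]
      simp only [append, merge_cons, h2]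
      module

theorem splits_one_left {X Y : C.Obj}
    {K : ∀ ⦃W : C.Obj⦄, Chain C W Y → Chain C X W → M}
    (h₁ : ∀ ⦃V W : C.Obj⦄ (v : Chain C W Y) (v' : Chain C V W) (u : Chain C X V),
      v.length + v'.length ≠ 0 → K (v.append (Chain.cons (C.one W) v')) u = 0)
    (h₂ : ∀ ⦃W : C.Obj⦄ (v : Chain C W Y), IsNormalized (K v)) (u : Chain C X Y) :
    splits (Chain.cons (C.one Y) u) K = K (Chain.cons (C.one Y) nil) u := by
  rw [splits_cons, (h₂ nil).head, zero_add, splits_eq_right]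
  intro W V n f v u
  exact h₁ nil (Chain.cons f v) u (by simp [length])

theorem splits_append_one_left {W X Y : C.Obj}
    {K : ∀ ⦃W : C.Obj⦄, Chain C W Y → Chain C X W → M}
    (h₁ : ∀ ⦃V W : C.Obj⦄ (v : Chain C W Y) (v' : Chain C V W) (u : Chain C X V),
      v.length + v'.length ≠ 0 → K (v.append (Chain.cons (C.one W) v')) u = 0)
    (h₂ : ∀ ⦃W : C.Obj⦄ (v : Chain C W Y), IsNormalized (K v)) (v : Chain C W Y)
    (u : Chain C X W) (hv : v.length ≠ 0) :
    splits (v.append (Chain.cons (C.one W) u)) K = 0 := by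
  cases v with
  | nil => exact absurd rfl hv
  | cons g v =>
    rw [append, splits_cons, (h₂ nil).tail, zero_add]
    exact isNormalized_splits
      (fun W u V v' u' => h₁ (Chain.cons g v') u' u (by simp [length]))
      (fun W v => h₂ (Chain.cons g v)) v u

theorem splits_one_right {W X Y : C.Obj}
    {K : ∀ ⦃W : C.Obj⦄, Chain C W Y → Chain C X W → M}
    (h₁ : ∀ ⦃W : C.Obj⦄ (u : Chain C X W), IsNormalized (fun v : Chain C W Y => K v u))
    (h₂ : ∀ ⦃V W : C.Obj⦄ (v : Chain C W Y) (u : Chain C V W) (u' : Chain C X V),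
      u.length + u'.length ≠ 0 → K v (u.append (Chain.cons (C.one V) u')) = 0)
    (v : Chain C W Y) (u : Chain C X W) :
    splits (v.append (Chain.cons (C.one W) u)) K = K v (Chain.cons (C.one W) u) := by
  induction v with
  | nil => rw [append, splits_cons, splits_eq_zero u fun V v u _ => (h₁ u).head v, add_zero]
  | cons g v ih =>
    rw [append, splits_cons, ih (fun W u => (h₁ u).cons g) (fun V W v => h₂ (Chain.cons g v))]
    rw [show K nil (Chain.cons g (v.append (Chain.cons (C.one W) u))) = 0 from
      h₂ nil (Chain.cons g v) u (by simp [length]), zero_add]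

end Chain

variable (C D : DGCat k)

theorem comp_index {X Y Z : D.Obj} (g : ∀ n, D.Hom Y Z n) (f : ∀ n, D.Hom X Y n)
    {a b a' b' r : ℤ} (h : a + b = r) (h' : a' + b' = r) (ha : a = a') :
    D.comp h (g a) (f b) = D.comp h' (g a') (f b') := by
  subst ha
  obtain rfl : b = b' := by omega
  rfl

theorem d_index {X Y : D.Obj} (f : ∀ n, D.Hom X Y n)
    {a a' b : ℤ} (h : a + 1 = b) (h' : a' + 1 = b) : D.d a b h (f a) = D.d a' b h' (f a') := by
  obtain rfl : a = a' := by omega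
  rfl

theorem comp_single {X Y Z : D.Obj} {n m : ℤ} (g : D.Hom Y Z n) (f : D.Hom X Y m)
    {a b r : ℤ} (h : a + b = r) (ha : a = n) :
    D.comp h (Pi.single n g a : D.Hom Y Z a) (Pi.single m f b : D.Hom X Y b) =
      (Pi.single (n + m) (D.comp rfl g f) r : D.Hom X Z r) := by
  subst ha
  rw [Pi.single_eq_same]
  by_cases hb : b = m
  · subst hb; subst h; simp
  · rw [Pi.single_eq_of_ne hb, Pi.single_eq_of_ne (by omega), map_zero]

theorem d_single {X Y : D.Obj} {n : ℤ} (f : D.Hom X Y n) {a b : ℤ} (h : a + 1 = b) :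
    D.d a b h (Pi.single n f a : D.Hom X Y a) =
      (Pi.single (n + 1) (D.d n (n + 1) rfl f) b : D.Hom X Y b) := by
  by_cases ha : a = n
  · subst ha; subst h; simp
  · rw [Pi.single_eq_of_ne ha, Pi.single_eq_of_ne (by omega), map_zero]

/-- Families of functions from the chains in `C` to the graded morphisms of `D`, with prescribed
effect on source and target. -/
abbrev RawCochain (φ ψ : C.Obj → D.Obj) : Type u :=
  ∀ ⦃X Y : C.Obj⦄, Chain C X Y → ∀ q : ℤ, D.Hom (φ X) (ψ Y) q

/-- The cochains of degree `p`: the product over `n` and over `X₀, …, Xₙ` of the degree `p` parts of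
`Hom(C(Xₙ₋₁,Xₙ)[1] ⊗ ⋯ ⊗ C(X₀,X₁)[1], D(φ X₀, ψ Xₙ))`. -/
def cochains (φ ψ : C.Obj → D.Obj) (p : ℤ) : Submodule k (RawCochain C D φ ψ) where
  carrier := {Ψ | (∀ ⦃X Y : C.Obj⦄ (c : Chain C X Y) (q : ℤ), q ≠ p + c.deg → Ψ c q = 0) ∧
    ∀ (X Y : C.Obj) (q : ℤ), Chain.IsMultilinear (fun c : Chain C X Y => Ψ c q)}
  zero_mem' := ⟨fun _ _ _ _ _ => rfl, fun _ _ _ _ _ _ _ _ _ _ _ => by simp⟩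
  add_mem' := by
    rintro Ψ Φ ⟨h₁, h₂⟩ ⟨h₃, h₄⟩
    refine ⟨fun X Y c q hq => ?_, fun X Y q W Z n v u a f f' => ?_⟩
    · simp [h₁ c q hq, h₃ c q hq]
    · have h₅ := h₂ X Y q v u a f f'
      have h₆ := h₄ X Y q v u a f f'
      simp only [Pi.add_apply] at h₅ h₆ ⊢
      rw [h₅, h₆]; module
  smul_mem' := by
    rintro b Ψ ⟨h₁, h₂⟩
    refine ⟨fun X Y c q hq => ?_, fun X Y q W Z n v u a f f' => ?_⟩
    · simp [h₁ c q hq]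
    · have h₅ := h₂ X Y q v u a f f'
      simp only [Pi.smul_apply] at h₅ ⊢
      rw [h₅]; module

/-- The normalized cochains of degree `p`, those that vanish as soon as one of the arguments is an
identity. -/
def normalizedCochains (φ ψ : C.Obj → D.Obj) (p : ℤ) : Submodule k (RawCochain C D φ ψ) where
  carrier := {Ψ | Ψ ∈ cochains C D φ ψ p ∧
    ∀ (X Y : C.Obj) (q : ℤ), Chain.IsNormalized (fun c : Chain C X Y => Ψ c q)}
  zero_mem' := ⟨zero_mem _, fun _ _ _ _ _ _ => rfl⟩
  add_mem' := by
    rintro Ψ Φ ⟨h₁, h₂⟩ ⟨h₃, h₄⟩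
    refine ⟨add_mem h₁ h₃, fun X Y q W v u => ?_⟩
    have h₅ := h₂ X Y q v u
    have h₆ := h₄ X Y q v u
    simp only [Pi.add_apply] at h₅ h₆ ⊢
    rw [h₅, h₆, add_zero]
  smul_mem' := by
    rintro b Ψ ⟨h₁, h₂⟩
    refine ⟨Submodule.smul_mem _ _ h₁, fun X Y q W v u => ?_⟩
    have h₅ := h₂ X Y q v u
    simp only [Pi.smul_apply] at h₅ ⊢
    rw [h₅, smul_zero]

variable {C D}

/-- The differential `d_D ∘ Ψ - (-1)^p Ψ ∘ b` of a cochain of degree `p`, without the terms that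
involve functors. -/
def del {φ ψ : C.Obj → D.Obj} (p : ℤ) (Ψ : RawCochain C D φ ψ) : RawCochain C D φ ψ :=
  fun _ _ c q => D.d (q - 1) q (sub_add_cancel q 1) (Ψ c (q - 1)) -
    koszulSign k p • Chain.bar c (fun c' => Ψ c' q)

/-- The cup product of cochains of degrees `p` and `p'`,
`(Ψ ∪ Φ)(c) = ∑ (-1)^(p' |v|) Ψ(v) ∘ Φ(u)` over the decompositions `c = v ++ u`. -/
def cup {φ ψ χ : C.Obj → D.Obj} (p p' : ℤ) (Ψ : RawCochain C D ψ χ) (Φ : RawCochain C D φ ψ) :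
    RawCochain C D φ χ :=
  fun _ _ c q => Chain.splits c (fun _ v u => koszulSign k (p' * v.deg) •
    D.comp (add_sub_cancel (p + v.deg) q) (Ψ v (p + v.deg)) (Φ u (q - (p + v.deg))))

/-- The cochain of degree `0` that consists of the identities `φ X ⟶ φ X`. -/
def unitCochain (φ : C.Obj → D.Obj) : RawCochain C D φ φ
  | X, _, Chain.nil => Pi.single 0 (D.one (φ X))
  | _, _, Chain.cons _ _ => 0

section cochainLemmas

variable {φ ψ χ ω : C.Obj → D.Obj}

theorem del_add (p : ℤ) (Ψ Ψ' : RawCochain C D φ ψ) :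
    del p (Ψ + Ψ') = del p Ψ + del p Ψ' := by
  funext X Y c q
  simp only [del, Pi.add_apply, map_add, Chain.bar_add]
  module

theorem del_smul (p : ℤ) (a : k) (Ψ : RawCochain C D φ ψ) :
    del p (a • Ψ) = a • del p Ψ := by
  funext X Y c q
  simp only [del, Pi.smul_apply, map_smul, Chain.bar_smul]
  module

theorem cup_add_left (p p' : ℤ) (Ψ Ψ' : RawCochain C D ψ χ) (Φ : RawCochain C D φ ψ) :
    cup p p' (Ψ + Ψ') Φ = cup p p' Ψ Φ + cup p p' Ψ' Φ := by
  funext X Y c q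
  simp only [cup, Pi.add_apply, map_add, LinearMap.add_apply, smul_add, Chain.splits_add]

theorem cup_add_right (p p' : ℤ) (Ψ : RawCochain C D ψ χ) (Φ Φ' : RawCochain C D φ ψ) :
    cup p p' Ψ (Φ + Φ') = cup p p' Ψ Φ + cup p p' Ψ Φ' := by
  funext X Y c q
  simp only [cup, Pi.add_apply, map_add, smul_add, Chain.splits_add]

theorem cup_smul_left (p p' : ℤ) (a : k) (Ψ : RawCochain C D ψ χ) (Φ : RawCochain C D φ ψ) :
    cup p p' (a • Ψ) Φ = a • cup p p' Ψ Φ := by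
  funext X Y c q
  simp only [cup, Pi.smul_apply, map_smul, LinearMap.smul_apply, smul_comm _ a,
    Chain.splits_smul]

theorem cup_smul_right (p p' : ℤ) (a : k) (Ψ : RawCochain C D ψ χ) (Φ : RawCochain C D φ ψ) :
    cup p p' Ψ (a • Φ) = a • cup p p' Ψ Φ := by
  funext X Y c q
  simp only [cup, Pi.smul_apply, map_smul, smul_comm _ a, Chain.splits_smul]

theorem cup_assoc {pa pb pc pab pbc : ℤ} (hab : pa + pb = pab) (hbc : pb + pc = pbc)
    (A : RawCochain C D χ ω) (B : RawCochain C D ψ χ) (E : RawCochain C D φ ψ) :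
    cup pab pc (cup pa pb A B) E = cup pa pbc A (cup pb pc B E) := by
  subst hab hbc
  funext X Y c q
  have hR : cup pa (pb + pc) A (cup pb pc B E) c q =
      Chain.splits c (fun _ v u => Chain.splits u (fun _ u₁ u₂ =>
        koszulSign k ((pb + pc) * v.deg) • koszulSign k (pc * u₁.deg) •
          D.comp (add_sub_cancel (pa + v.deg) q) (A v (pa + v.deg))
            (D.comp (add_sub_cancel (pb + u₁.deg) (q - (pa + v.deg))) (B u₁ (pb + u₁.deg))
              (E u₂ (q - (pa + v.deg) - (pb + u₁.deg)))))) := by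
    simp only [cup]
    congr 1
    funext W v u
    rw [Chain.map_splits (D.comp (add_sub_cancel (pa + v.deg) q) (A v (pa + v.deg))),
      ← Chain.splits_smul]
    simp only [map_smul]
  rw [hR, ← Chain.splits_assoc c (fun _ _ v u₁ u₂ =>
        koszulSign k ((pb + pc) * v.deg) • koszulSign k (pc * u₁.deg) •
          D.comp (add_sub_cancel (pa + v.deg) q) (A v (pa + v.deg))
            (D.comp (add_sub_cancel (pb + u₁.deg) (q - (pa + v.deg))) (B u₁ (pb + u₁.deg))
              (E u₂ (q - (pa + v.deg) - (pb + u₁.deg)))))]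
  simp only [cup]
  congr 1
  funext W v u
  rw [← LinearMap.flip_apply, Chain.map_splits, ← Chain.splits_smul]
  refine Chain.splits_congr _ fun V v₁ v₂ hv => ?_
  rw [LinearMap.flip_apply, map_smul, LinearMap.smul_apply]
  have e₁ : pa + pb + v.deg - (pa + v₁.deg) + (q - (pa + pb + v.deg)) = q - (pa + v₁.deg) := by
    ring
  rw [D.assoc _ _ e₁ (add_sub_cancel _ _)]
  have e₂ : pb + v₂.deg + (q - (pa + v₁.deg) - (pb + v₂.deg)) = q - (pa + v₁.deg) := by ring
  rw [comp_index D (fun n => B v₂ n) (fun n => E u n) e₁ e₂ (by omega), ← hv, mul_add, add_mul,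
    koszulSign_add, koszulSign_add]
  module

theorem del_cup {p p' r : ℤ} (h : p + p' = r) {p₁ p₁' : ℤ} (h₁ : p + 1 = p₁) (h₁' : p' + 1 = p₁')
    (A : RawCochain C D ψ χ) (B : RawCochain C D φ ψ) :
    del r (cup p p' A B) =
      cup p₁ p' (del p A) B + koszulSign k p • cup p p₁' A (del p' B) := by
  subst h h₁ h₁'
  funext X Y c q
  simp only [del, cup, Pi.add_apply, Pi.smul_apply]
  rw [Chain.map_splits, Chain.bar_splits, sub_eq_add_neg, ← neg_smul, ← Chain.splits_smul,
    ← Chain.splits_smul, ← Chain.splits_add, ← Chain.splits_add]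
  refine Chain.splits_congr _ fun W v u _ => ?_
  have e₁ : p + 1 + v.deg + (q - (p + 1 + v.deg)) = q := by ring
  have e₂ : p + v.deg + (q - 1 - (p + v.deg) + 1) = q := by ring
  have e₃ : p + v.deg + (q - (p + v.deg)) = q := by ring
  have hb₁ : Chain.bar v (fun v' => koszulSign k (p' * v'.deg) •
      D.comp (add_sub_cancel (p + v'.deg) q) (A v' (p + v'.deg)) (B u (q - (p + v'.deg)))) =
      (koszulSign k (p' * v.deg) * koszulSign k p') •
        D.comp e₁ (Chain.bar v (fun v' => A v' (p + 1 + v.deg))) (B u (q - (p + 1 + v.deg))) := by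
    rw [← LinearMap.flip_apply, Chain.map_bar, ← Chain.bar_smul]
    refine Chain.bar_congr _ fun v' hv' => ?_
    rw [LinearMap.flip_apply, comp_index D (fun n => A v' n) (fun n => B u n)
      (add_sub_cancel (p + v'.deg) q) e₁ (by omega), hv', mul_add, mul_one, koszulSign_add]
  have hb₂ : Chain.bar u (fun u' => koszulSign k (p' * v.deg) •
      D.comp (add_sub_cancel (p + v.deg) q) (A v (p + v.deg)) (B u' (q - (p + v.deg)))) =
      koszulSign k (p' * v.deg) •
        D.comp e₃ (A v (p + v.deg)) (Chain.bar u (fun u' => B u' (q - (p + v.deg)))) := by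
    rw [Chain.map_bar (D.comp e₃ (A v (p + v.deg))), ← Chain.bar_smul]
  have e₄ : p + v.deg + 1 + (q - 1 - (p + v.deg)) = q := by ring
  have e₅ : p + v.deg + (q - 1 - (p + v.deg) + 1) = q := by ring
  have e₆ : p + 1 + v.deg - 1 + 1 = p + 1 + v.deg := by ring
  have hd : D.d (q - 1) q (sub_add_cancel q 1) (D.comp (add_sub_cancel (p + v.deg) (q - 1))
      (A v (p + v.deg)) (B u (q - 1 - (p + v.deg)))) =
      D.comp e₁ (D.d _ _ e₆ (A v (p + 1 + v.deg - 1))) (B u (q - (p + 1 + v.deg))) +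
        koszulSign k (p + v.deg) • D.comp e₃ (A v (p + v.deg))
          (D.d _ _ (sub_add_cancel _ 1) (B u (q - (p + v.deg) - 1))) := by
    rw [D.leibniz (add_sub_cancel (p + v.deg) (q - 1)) rfl rfl (sub_add_cancel q 1) e₄ e₅]
    have h₁ := comp_index D (fun n => D.d (n - 1) n (sub_add_cancel _ _) (A v (n - 1)))
      (fun n => B u n) e₄ e₁ (by ring)
    have h₂ := comp_index D (fun n => A v n)
      (fun n => D.d (n - 1) n (sub_add_cancel _ _) (B u (n - 1))) e₅ e₃ rfl
    rw [← h₁, ← h₂]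
    rw [d_index D (fun n => A v n) (sub_add_cancel (p + v.deg + 1) 1) rfl,
      d_index D (fun n => B u n) (sub_add_cancel (q - 1 - (p + v.deg) + 1) 1) rfl]
  rw [map_smul, hd, hb₁, hb₂]
  simp only [map_sub, map_smul, LinearMap.sub_apply, LinearMap.smul_apply, add_mul, one_mul,
    koszulSign_add]
  rcases koszulSign_cases k p with h | h <;> rcases koszulSign_cases k p' with h' | h' <;>
    rcases koszulSign_cases k v.deg with h'' | h'' <;> rw [h, h', h''] <;> module

end cochainLemmas
end DGCat

namespace DGCat

variable {k : Type u} [Field k] {C D : DGCat k}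

section cochainLemmas

variable {φ ψ χ ω : C.Obj → D.Obj}

theorem del_del {p p₁ : ℤ} (h : p + 1 = p₁) {Ψ : RawCochain C D φ ψ}
    (hΨ : Ψ ∈ cochains C D φ ψ p) : del p₁ (del p Ψ) = 0 := by
  subst h
  funext X Y c q
  have h := Chain.bar_bar c _ (hΨ.2 X Y q)
  have hsub : ∀ a b : D.Hom (φ X) (ψ Y) q, a - b = a + (-1 : k) • b := by
    intro a b; module
  simp only [del, map_sub, map_smul, Chain.map_bar (D.d (q - 1) q (sub_add_cancel q 1)), D.d_d,
    hsub, Chain.bar_add, Chain.bar_smul, h, koszulSign_add, koszulSign_one, Pi.zero_apply]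
  module

theorem single_one_comp {X Y : D.Obj} (f : ∀ n, D.Hom X Y n) {a b r : ℤ} (h : a + b = r)
    (ha : a = 0) : D.comp h (Pi.single 0 (D.one Y) a : D.Hom Y Y a) (f b) = f r := by
  subst ha
  obtain rfl : b = r := by omega
  rw [Pi.single_eq_same]
  exact D.one_comp _

theorem comp_single_one {X Y : D.Obj} (f : ∀ n, D.Hom X Y n) {a b r : ℤ} (h : a + b = r)
    (ha : r ≠ a → f r = 0) : D.comp h (f a) (Pi.single 0 (D.one X) b : D.Hom X X b) = f r := by
  by_cases hb : b = 0
  · subst hb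
    obtain rfl : a = r := by omega
    rw [Pi.single_eq_same]
    exact D.comp_one _
  · rw [Pi.single_eq_of_ne hb, map_zero, ha (by omega)]

theorem cup_unit_left (p : ℤ) (Ψ : RawCochain C D φ ψ) :
    cup 0 p (unitCochain ψ) Ψ = Ψ := by
  funext X Y c q
  rw [cup, Chain.splits_eq_right]
  · simp only [Chain.deg_nil, mul_zero, koszulSign_zero, one_smul]
    exact single_one_comp (fun n => Ψ c n) _ (add_zero 0)
  · intros
    simp [unitCochain]

theorem cup_unit_right {p : ℤ} {Ψ : RawCochain C D φ ψ} (hΨ : Ψ ∈ cochains C D φ ψ p) :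
    cup p 0 Ψ (unitCochain φ) = Ψ := by
  funext X Y c q
  rw [cup, Chain.splits_eq_left]
  · simp only [zero_mul, koszulSign_zero, one_smul]
    exact comp_single_one (fun n => Ψ c n) _ (hΨ.1 c q)
  · intros
    simp [unitCochain]

theorem unitCochain_mem (φ : C.Obj → D.Obj) :
    unitCochain φ ∈ normalizedCochains C D φ φ 0 := by
  refine ⟨⟨fun X Y c q hq => ?_, fun X Y q W Z n v u a f f' => ?_⟩, fun X Y q W v u => ?_⟩
  · cases c with
    | nil => exact Pi.single_eq_of_ne (by simpa [Chain.deg] using hq) _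
    | cons f c => rfl
  · cases v <;> simp [unitCochain, Chain.append]
  · cases v <;> simp [unitCochain, Chain.append]

theorem del_mem {p p₁ : ℤ} (h : p + 1 = p₁) {Ψ : RawCochain C D φ ψ}
    (hΨ : Ψ ∈ cochains C D φ ψ p) : del p Ψ ∈ cochains C D φ ψ p₁ := by
  subst h
  refine ⟨fun X Y c q hq => ?_, fun X Y q W Z n v u a f f' => ?_⟩
  · rw [del, hΨ.1 c (q - 1) (by omega), map_zero,
      Chain.bar_eq_zero c fun c' hc => hΨ.1 c' q (by omega), smul_zero, sub_zero]
  · have h₁ := hΨ.2 X Y (q - 1) v u a f f'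
    have h₂ := (hΨ.2 X Y q).bar v u a f f'
    dsimp only at h₁ h₂
    simp only [del, h₁, h₂, map_add, map_smul]
    module

theorem cup_isMultilinear {p p' : ℤ} {A : RawCochain C D ψ χ} {B : RawCochain C D φ ψ}
    (hA : A ∈ cochains C D ψ χ p) (hB : B ∈ cochains C D φ ψ p') (X Y : C.Obj) (q : ℤ) :
    Chain.IsMultilinear (fun c : Chain C X Y => cup p p' A B c q) := by
  refine Chain.isMultilinear_splits (fun V u₀ W Z n v u a f f' => ?_)
    (fun V v₀ W Z n v u a f f' => ?_)
  · have e : p + (v.deg + (n - 1 + u.deg)) + (q - (p + (v.deg + (n - 1 + u.deg)))) = q := by ring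
    have key : ∀ g : C.Hom W Z n, D.comp (add_sub_cancel (p + (v.append (Chain.cons g u)).deg) q)
        (A (v.append (Chain.cons g u)) (p + (v.append (Chain.cons g u)).deg))
        (B u₀ (q - (p + (v.append (Chain.cons g u)).deg))) =
        D.comp e (A (v.append (Chain.cons g u)) (p + (v.deg + (n - 1 + u.deg))))
          (B u₀ (q - (p + (v.deg + (n - 1 + u.deg))))) := fun g =>
      comp_index D (fun n => A (v.append (Chain.cons g u)) n) (fun n => B u₀ n) _ _
        (by rw [Chain.deg_append, Chain.deg_cons])
    have h := hA.2 _ _ (p + (v.deg + (n - 1 + u.deg))) v u a f f'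
    dsimp only at h ⊢
    rw [key, key, key, h]
    simp only [Chain.deg_append, Chain.deg_cons, map_add, map_smul, LinearMap.add_apply,
      LinearMap.smul_apply]
    module
  · have h := hB.2 _ _ (q - (p + v₀.deg)) v u a f f'
    dsimp only at h ⊢
    rw [h]
    simp only [map_add, map_smul]
    module

theorem cup_mem {p p' r : ℤ} (h : p + p' = r) {A : RawCochain C D ψ χ} {B : RawCochain C D φ ψ}
    (hA : A ∈ cochains C D ψ χ p) (hB : B ∈ cochains C D φ ψ p') :
    cup p p' A B ∈ cochains C D φ χ r := by
  subst h
  refine ⟨fun X Y c q hq => Chain.splits_eq_zero c fun W v u hvu => ?_,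
    cup_isMultilinear hA hB⟩
  rw [hB.1 u _ (by omega), map_zero, smul_zero]

theorem cup_mem_normalized {p p' r : ℤ} (h : p + p' = r) {A : RawCochain C D ψ χ}
    {B : RawCochain C D φ ψ} (hA : A ∈ normalizedCochains C D ψ χ p)
    (hB : B ∈ normalizedCochains C D φ ψ p') :
    cup p p' A B ∈ normalizedCochains C D φ χ r := by
  refine ⟨cup_mem h hA.1 hB.1, fun X Y q => Chain.isNormalized_splits
    (fun V u₀ W v u => ?_) (fun V v₀ W v u => ?_)⟩
  · have h := hA.2 _ _ (p + (v.append (Chain.cons (C.one W) u)).deg) v u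
    dsimp only at h ⊢
    rw [h]; simp
  · have h := hB.2 _ _ (q - (p + v₀.deg)) v u
    dsimp only at h ⊢
    rw [h]; simp

end cochainLemmas

/-- A dg functor. -/
structure DGFunctor (C D : DGCat k) where
  obj : C.Obj → D.Obj
  map : ∀ {X Y : C.Obj} (n : ℤ), C.Hom X Y n →ₗ[k] D.Hom (obj X) (obj Y) n
  map_d : ∀ {X Y : C.Obj} {n m : ℤ} (h : n + 1 = m) (f : C.Hom X Y n),
    map m (C.d n m h f) = D.d n m h (map n f)
  map_one : ∀ X : C.Obj, map 0 (C.one X) = D.one (obj X)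
  map_comp : ∀ {X Y Z : C.Obj} {p q r : ℤ} (h : p + q = r) (g : C.Hom Y Z p) (f : C.Hom X Y q),
    map r (C.comp h g f) = D.comp h (map p g) (map q f)

/-- A (strictly unital) `A∞`-functor between dg categories, given by the twisting cochain
`tw([fₙ|…|f₁]) = ± Fₙ(fₙ, …, f₁)`, `n ≥ 1`, on the bar construction of `C`. The component `Fₙ` is
multilinear of degree `1 - n`, the Maurer-Cartan equation is the system of `A∞`-functor equations,
and the last two fields say that `F₁` preserves identities and that `Fₙ`, `n ≥ 2`, vanishes if one
of its arguments is an identity. -/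
structure AInfFunctor (C D : DGCat k) where
  obj : C.Obj → D.Obj
  tw : RawCochain C D obj obj
  tw_mem : tw ∈ cochains C D obj obj 1
  tw_nil : ∀ (X : C.Obj) (q : ℤ), tw (Chain.nil : Chain C X X) q = 0
  maurerCartan : del 1 tw + cup 1 1 tw tw = 0
  tw_one : ∀ X : C.Obj, tw (Chain.cons (C.one X) Chain.nil) = Pi.single 0 (D.one (obj X))
  tw_unital : ∀ ⦃X Y Z : C.Obj⦄ (v : Chain C Y Z) (u : Chain C X Y), v.length + u.length ≠ 0 →
    ∀ q : ℤ, tw (v.append (Chain.cons (C.one Y) u)) q = 0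

/-- The differential `d_D ∘ Ψ - (-1)^p Ψ ∘ b + G ∪ Ψ - (-1)^p Ψ ∪ F` on the cochains of degree `p`
that are the coherent natural transformations from `F` to `G`. -/
def twistedDiff (F G : AInfFunctor C D) (p : ℤ) :
    RawCochain C D F.obj G.obj →ₗ[k] RawCochain C D F.obj G.obj where
  toFun Ψ := del p Ψ + cup 1 p G.tw Ψ - koszulSign k p • cup p 1 Ψ F.tw
  map_add' Ψ Ψ' := by
    rw [del_add, cup_add_left, cup_add_right]; module
  map_smul' a Ψ := by
    rw [del_smul, cup_smul_left, cup_smul_right, RingHom.id_apply]; module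

theorem twistedDiff_apply (F G : AInfFunctor C D) (p : ℤ) (Ψ : RawCochain C D F.obj G.obj) :
    twistedDiff F G p Ψ =
      del p Ψ + cup 1 p G.tw Ψ - koszulSign k p • cup p 1 Ψ F.tw := rfl

theorem twistedDiff_mem (F G : AInfFunctor C D) {p r : ℤ} (h : p + 1 = r)
    {Ψ : RawCochain C D F.obj G.obj} (hΨ : Ψ ∈ normalizedCochains C D F.obj G.obj p) :
    twistedDiff F G p Ψ ∈ normalizedCochains C D F.obj G.obj r := by
  refine ⟨sub_mem (add_mem (del_mem h hΨ.1) (cup_mem (by omega) G.tw_mem hΨ.1))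
    (Submodule.smul_mem _ _ (cup_mem h hΨ.1 F.tw_mem)), fun X Y q W v u => ?_⟩
  -- the two cups with the twisting cochains
  have hl₁ : ∀ ⦃V W : C.Obj⦄ (v : Chain C W Y) (v' : Chain C V W) (u : Chain C X V),
      v.length + v'.length ≠ 0 →
      koszulSign k (p * (v.append (Chain.cons (C.one W) v')).deg) •
        D.comp (add_sub_cancel (1 + (v.append (Chain.cons (C.one W) v')).deg) q)
        (G.tw (v.append (Chain.cons (C.one W) v'))
          (1 + (v.append (Chain.cons (C.one W) v')).deg))
        (Ψ u (q - (1 + (v.append (Chain.cons (C.one W) v')).deg))) = 0 := by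
    intro V W v v' u hv
    rw [G.tw_unital v v' hv, map_zero, LinearMap.zero_apply, smul_zero]
  have hl₂ : ∀ ⦃W : C.Obj⦄ (v : Chain C W Y), Chain.IsNormalized (fun u : Chain C X W =>
      koszulSign k (p * v.deg) • D.comp (add_sub_cancel (1 + v.deg) q) (G.tw v (1 + v.deg))
        (Ψ u (q - (1 + v.deg)))) := by
    intro W v V w u
    have h := hΨ.2 _ _ (q - (1 + v.deg)) w u
    dsimp only at h ⊢
    rw [h, map_zero, smul_zero]
  have hr₁ : ∀ ⦃W : C.Obj⦄ (u : Chain C X W), Chain.IsNormalized (fun v : Chain C W Y =>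
      koszulSign k (1 * v.deg) • D.comp (add_sub_cancel (p + v.deg) q) (Ψ v (p + v.deg))
        (F.tw u (q - (p + v.deg)))) := by
    intro W u V v w
    have h := hΨ.2 _ _ (p + (v.append (Chain.cons (C.one V) w)).deg) v w
    dsimp only at h ⊢
    rw [h, map_zero, LinearMap.zero_apply, smul_zero]
  have hr₂ : ∀ ⦃V W : C.Obj⦄ (v : Chain C W Y) (u : Chain C V W) (u' : Chain C X V),
      u.length + u'.length ≠ 0 →
      koszulSign k (1 * v.deg) • D.comp (add_sub_cancel (p + v.deg) q) (Ψ v (p + v.deg))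
        (F.tw (u.append (Chain.cons (C.one V) u')) (q - (p + v.deg))) = 0 := by
    intro V W v u u' hu
    rw [F.tw_unital u u' hu, map_zero, smul_zero]
  have hL₀ : ∀ u : Chain C X Y, cup 1 p G.tw Ψ (Chain.cons (C.one Y) u) q =
      koszulSign k p • Ψ u q := by
    intro u
    rw [cup, Chain.splits_one_left hl₁ hl₂, G.tw_one,
      single_one_comp (fun n => Ψ u n) _ (by simp [Chain.deg])]
    simp only [Chain.deg, add_zero, zero_sub, mul_neg, mul_one]
    rw [← zero_sub, koszulSign_sub, koszulSign_zero, one_mul]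
  have hL₁ : ∀ ⦃W : C.Obj⦄ (v : Chain C W Y) (u : Chain C X W), v.length ≠ 0 →
      cup 1 p G.tw Ψ (v.append (Chain.cons (C.one W) u)) q = 0 := fun W v u hv =>
    Chain.splits_append_one_left hl₁ hl₂ v u hv
  have hR₀ : ∀ v : Chain C X Y, cup p 1 Ψ F.tw (v.append (Chain.cons (C.one X) Chain.nil)) q =
      koszulSign k v.deg • Ψ v q := by
    intro v
    rw [cup, Chain.splits_one_right hr₁ hr₂, F.tw_one, one_mul,
      comp_single_one (fun n => Ψ v n) _ (hΨ.1.1 v q)]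
  have hR₁ : ∀ ⦃W : C.Obj⦄ (v : Chain C W Y) (u : Chain C X W), u.length ≠ 0 →
      cup p 1 Ψ F.tw (v.append (Chain.cons (C.one W) u)) q = 0 := by
    intro W v u hu
    rw [cup, Chain.splits_one_right hr₁ hr₂]
    exact hr₂ v Chain.nil u (by simpa [Chain.length] using hu)
  have hm := hΨ.1.2 X Y q
  have hn := hΨ.2 X Y q
  have h₀ := hΨ.2 X Y (q - 1) v u
  dsimp only at h₀
  dsimp only
  rw [twistedDiff_apply]
  simp only [Pi.sub_apply, Pi.add_apply, Pi.smul_apply, del]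
  rw [h₀, map_zero]
  cases v with
  | nil =>
    rw [Chain.append, hL₀]
    cases u with
    | nil =>
      have hr := hR₀ Chain.nil
      rw [Chain.append, Chain.deg_nil, koszulSign_zero, one_smul] at hr
      rw [hr, Chain.bar_one_nil hm]; module
    | cons f u =>
      have hr := hR₁ Chain.nil (Chain.cons f u) (by simp [Chain.length])
      rw [Chain.append] at hr
      rw [hr, Chain.bar_one hm hn _ (by simp [Chain.length])]; module
  | cons g v =>
    rw [hL₁ _ _ (by simp [Chain.length])]
    cases u with
    | nil =>
      rw [hR₀, Chain.bar_append_one_nil hm hn _ (by simp [Chain.length])]; module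
    | cons f u =>
      rw [hR₁ _ _ (by simp [Chain.length]),
        Chain.bar_append_one hm hn _ _ (by simp [Chain.length]) (by simp [Chain.length])]
      module

theorem twistedDiff_twistedDiff (F G : AInfFunctor C D) {p r : ℤ} (h : p + 1 = r)
    {Ψ : RawCochain C D F.obj G.obj} (hΨ : Ψ ∈ cochains C D F.obj G.obj p) :
    twistedDiff F G r (twistedDiff F G p Ψ) = 0 := by
  have hs : koszulSign k r = -koszulSign k p := by
    rw [← h, koszulSign_add, koszulSign_one]; ring
  have hss := koszulSign_mul_self k p
  have h₁ : 1 + p = r := by omega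
  have e₁ := del_del h hΨ
  have e₂ := del_cup h₁ (show (1 : ℤ) + 1 = 2 by rfl) h G.tw Ψ
  have e₃ := del_cup h h (show (1 : ℤ) + 1 = 2 by rfl) Ψ F.tw
  have e₄ := cup_assoc (show (1 : ℤ) + 1 = 2 by rfl) h₁ G.tw G.tw Ψ
  have e₅ := cup_assoc h (show (1 : ℤ) + 1 = 2 by rfl) Ψ F.tw F.tw
  have e₆ := cup_assoc h₁ h G.tw Ψ F.tw
  have e₇ : cup 2 p (del 1 G.tw + cup 1 1 G.tw G.tw) Ψ = 0 := by
    rw [G.maurerCartan]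
    simpa using cup_smul_left 2 p 0 (0 : RawCochain C D G.obj G.obj) Ψ
  have e₈ : cup p 2 Ψ (del 1 F.tw + cup 1 1 F.tw F.tw) = 0 := by
    rw [F.maurerCartan]
    simpa using cup_smul_right p 2 0 Ψ (0 : RawCochain C D F.obj F.obj)
  rw [cup_add_left, e₄] at e₇
  rw [cup_add_right, ← e₅] at e₈
  rw [koszulSign_one] at e₂
  have hsub : ∀ {a b : RawCochain C D F.obj G.obj}, a - b = a + (-1 : k) • b := by
    intro a b; module
  simp only [twistedDiff_apply, hsub, del_add, del_smul, cup_add_left, cup_add_right,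
    cup_smul_left, cup_smul_right, e₁, e₂, e₃, e₆, hs]
  have e₇' := eq_neg_of_add_eq_zero_left e₇
  have e₈' := eq_neg_of_add_eq_zero_left e₈
  rw [e₇', e₈']
  rcases koszulSign_cases k p with h | h <;> rw [h] <;> module

theorem twistedDiff_cup (F G H : AInfFunctor C D) {p p' r p₁ p₁' : ℤ} (h : p + p' = r)
    (h₁ : p + 1 = p₁) (h₁' : p' + 1 = p₁') (A : RawCochain C D G.obj H.obj)
    (B : RawCochain C D F.obj G.obj) :
    twistedDiff F H r (cup p p' A B) = cup p₁ p' (twistedDiff G H p A) B +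
      koszulSign k p • cup p p₁' A (twistedDiff F G p' B) := by
  have hs : koszulSign k r = koszulSign k p * koszulSign k p' := by
    rw [← h, koszulSign_add]
  have a₁ : 1 + p = p₁ := by omega
  have a₂ : 1 + p' = p₁' := by omega
  have hsub : ∀ {φ ψ : C.Obj → D.Obj} {a b : RawCochain C D φ ψ}, a - b = a + (-1 : k) • b := by
    intro φ ψ a b; module
  simp only [twistedDiff_apply, hsub, del_cup h h₁ h₁', cup_add_left, cup_add_right,
    cup_smul_left, cup_smul_right, cup_assoc a₁ h, cup_assoc h₁ a₂, cup_assoc h h₁', hs]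
  rcases koszulSign_cases k p with h | h <;> rw [h] <;> module

/-- The dg category of `A∞`-functors `C ⟶ D` and coherent natural transformations. -/
def cohAInf (C D : DGCat k) : DGCat k where
  Obj := AInfFunctor C D
  Hom F G p := normalizedCochains C D F.obj G.obj p
  d {F G} n _ h := (twistedDiff F G n).restrict fun _ hΨ => twistedDiff_mem F G h hΨ
  one F := ⟨unitCochain F.obj, unitCochain_mem F.obj⟩
  comp {_ _ _ p q _} h := LinearMap.mk₂ k
    (fun Ψ Φ => ⟨cup p q Ψ.1 Φ.1, cup_mem_normalized h Ψ.2 Φ.2⟩)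
    (fun _ _ _ => Subtype.ext (cup_add_left _ _ _ _ _))
    (fun _ _ _ => Subtype.ext (cup_smul_left _ _ _ _ _))
    (fun _ _ _ => Subtype.ext (cup_add_right _ _ _ _ _))
    (fun _ _ _ => Subtype.ext (cup_smul_right _ _ _ _ _))
  d_d {F G _ _ _} h _ Ψ := Subtype.ext (twistedDiff_twistedDiff F G h Ψ.2.1)
  one_comp Ψ := Subtype.ext (cup_unit_left _ Ψ.1)
  comp_one Ψ := Subtype.ext (cup_unit_right Ψ.2.1)
  assoc h₁ _ h₃ _ A B E := Subtype.ext (cup_assoc h₁ h₃ A.1 B.1 E.1)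
  leibniz {F G H _ _ _ _ _ _} h hp hq _ _ _ A B :=
    Subtype.ext (twistedDiff_cup F G H h hp hq A.1 B.1)

namespace DGFunctor

/-- The twisting cochain of a dg functor: its only component is `[f] ↦ F f`. -/
def twist (F : DGFunctor C D) : RawCochain C D F.obj F.obj
  | _, _, Chain.nil => 0
  | _, _, Chain.cons (n := n) f Chain.nil => Pi.single n (F.map n f)
  | _, _, Chain.cons _ (Chain.cons _ _) => 0

theorem twist_nil (F : DGFunctor C D) {X : C.Obj} :
    F.twist (Chain.nil : Chain C X X) = 0 := rfl

theorem twist_single (F : DGFunctor C D) {X Y : C.Obj} {n : ℤ} (f : C.Hom X Y n) :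
    F.twist (Chain.cons f Chain.nil) = Pi.single n (F.map n f) := rfl

theorem twist_cons_cons (F : DGFunctor C D) {X Y Z W : C.Obj} {n m : ℤ} (f : C.Hom Z W n)
    (g : C.Hom Y Z m) (c : Chain C X Y) : F.twist (Chain.cons f (Chain.cons g c)) = 0 := rfl

theorem twist_append (F : DGFunctor C D) {X Y Z W : C.Obj} {n : ℤ} (v : Chain C Z W)
    (f : C.Hom Y Z n) (u : Chain C X Y) (h : v.length + u.length ≠ 0) :
    F.twist (v.append (Chain.cons f u)) = 0 := by
  cases v with
  | nil =>
    cases u with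
    | nil => simp [Chain.length] at h
    | cons g u => rfl
  | cons g v => cases v <;> rfl

/-- A dg functor as an `A∞`-functor with vanishing higher components. -/
def toAInf (F : DGFunctor C D) : AInfFunctor C D where
  obj := F.obj
  tw := F.twist
  tw_mem := by
    refine ⟨fun X Y c q hq => ?_, fun X Y q W Z n v u a f f' => ?_⟩
    · cases c with
      | nil => rfl
      | cons f c =>
        cases c with
        | nil =>
          simp only [Chain.deg] at hq
          exact Pi.single_eq_of_ne (by omega) _
        | cons g c => rfl
    · by_cases h : v.length + u.length = 0
      · cases v with
        | nil =>
          cases u with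
          | nil =>
            simp only [Chain.append, twist_single, map_add, map_smul, Pi.single_add,
              Pi.single_smul, Pi.add_apply, Pi.smul_apply]
          | cons g u => simp [Chain.length] at h
        | cons g v => simp [Chain.length] at h
      · simp [twist_append F v _ u h]
  tw_nil _ _ := rfl
  maurerCartan := by
    funext X Y c q
    simp only [Pi.add_apply, Pi.zero_apply, del, cup]
    cases c with
    | nil => simp [twist, Chain.bar_nil, Chain.splits_nil]
    | cons g c =>
      rename_i Y' n
      cases c with
      | nil =>
        simp only [twist_single, Chain.bar_cons, Chain.merge_nil, Chain.bar_nil,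
          Chain.splits_cons, Chain.splits_nil, d_single, F.map_d]
        simp [twist, koszulSign_one]
      | cons f c =>
        cases c with
        | nil =>
          simp only [twist_single, twist_cons_cons, Chain.bar_cons, Chain.merge_nil,
            Chain.merge_cons, Chain.bar_nil, Chain.splits_cons, Chain.splits_nil]
          rw [comp_single _ _ _ _ (by simp [Chain.deg])]
          have hs : 1 * (Chain.cons g (Chain.nil : Chain C Y' Y')).deg = n - 1 := by
            simp [Chain.deg]
          simp only [twist_nil, Pi.zero_apply, map_zero, smul_zero, hs,
            F.map_comp, koszulSign_sub, koszulSign_one]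
          module
        | cons e c =>
          have h : Chain.splits c (fun W v u => koszulSign k (1 *
              (Chain.cons g (Chain.cons f (Chain.cons e v))).deg) •
              D.comp (add_sub_cancel (1 + (Chain.cons g (Chain.cons f (Chain.cons e v))).deg) q)
                (F.twist (Chain.cons g (Chain.cons f (Chain.cons e v)))
                  (1 + (Chain.cons g (Chain.cons f (Chain.cons e v))).deg))
                (F.twist u (q - (1 + (Chain.cons g (Chain.cons f (Chain.cons e v))).deg)))) = 0 :=
            Chain.splits_eq_zero c fun W v u _ => by simp [twist_cons_cons]
          have hb : Chain.bar (Chain.cons f (Chain.cons e c))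
              (fun c' => F.twist (Chain.cons g c') q) = 0 := by
            simp only [Chain.bar_cons, Chain.merge_cons, twist_cons_cons, Pi.zero_apply,
              Chain.bar_zero]
            cases c <;> simp
          rw [Chain.bar_cons, hb]
          rw [Chain.splits_cons, Chain.splits_cons, Chain.splits_cons, h]
          simp [Chain.merge_cons, twist]
  tw_one X := by rw [twist_single, F.map_one]
  tw_unital X Y Z v u h q := by rw [twist_append F v _ u h]; rfl

/-- The composition of dg functors, `F` first. -/
def comp {E : DGCat k} (F : DGFunctor C D) (G : DGFunctor D E) : DGFunctor C E where
  obj X := G.obj (F.obj X)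
  map n := (G.map n).comp (F.map n)
  map_d h f := by simp [F.map_d, G.map_d]
  map_one X := by simp [F.map_one, G.map_one]
  map_comp h g f := by simp [F.map_comp, G.map_comp]

end DGFunctor

/-- The dg category of dg functors `C ⟶ D` and coherent natural transformations: the complex of
morphisms from `F` to `G` is the normalized Hochschild cochain complex of `C` with coefficients in
the bimodule `D(F -, G -)`. -/
def cohDG (C D : DGCat k) : DGCat k where
  Obj := DGFunctor C D
  Hom F G p := (cohAInf C D).Hom F.toAInf G.toAInf p
  addCommGroupHom F G := (cohAInf C D).addCommGroupHom F.toAInf G.toAInf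
  moduleHom F G := (cohAInf C D).moduleHom F.toAInf G.toAInf
  d := (cohAInf C D).d
  one F := (cohAInf C D).one F.toAInf
  comp := (cohAInf C D).comp
  d_d := (cohAInf C D).d_d
  one_comp := (cohAInf C D).one_comp
  comp_one := (cohAInf C D).comp_one
  assoc := (cohAInf C D).assoc
  leibniz := (cohAInf C D).leibniz

/-- The natural embedding of `cohDG C D` into `cohAInf C D`, the identity on morphisms. -/
def cohInclusion (C D : DGCat k) : DGFunctor (cohDG C D) (cohAInf C D) where
  obj := DGFunctor.toAInf
  map _ := LinearMap.id
  map_d _ _ := rfl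
  map_one _ := rfl
  map_comp _ _ _ := rfl

section Cohomology

variable (C)

/-- The closed morphisms of degree `n`. -/
def cocycles (X Y : C.Obj) (n : ℤ) : Submodule k (C.Hom X Y n) :=
  LinearMap.ker (C.d n (n + 1) rfl)

/-- The exact morphisms of degree `n`. -/
def coboundaries (X Y : C.Obj) (n : ℤ) : Submodule k (C.Hom X Y n) :=
  LinearMap.range (C.d (n - 1) n (sub_add_cancel n 1))

/-- The cohomology `Hⁿ(C(X, Y))`. -/
abbrev Cohomology (X Y : C.Obj) (n : ℤ) : Type u :=
  C.cocycles X Y n ⧸ (C.coboundaries X Y n).comap (C.cocycles X Y n).subtype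

variable {C}

theorem one_mem_cocycles (X : C.Obj) : C.one X ∈ C.cocycles X X 0 := C.d_one X rfl

theorem comp_mem_cocycles {X Y Z : C.Obj} (g : C.cocycles Y Z 0) (f : C.cocycles X Y 0) :
    C.comp (zero_add 0) g.1 f.1 ∈ C.cocycles X Z 0 := by
  have hg : C.d 0 (0 + 1) rfl g.1 = 0 := g.2
  have hf : C.d 0 (0 + 1) rfl f.1 = 0 := f.2
  change C.d 0 (0 + 1) rfl _ = 0
  rw [C.leibniz (zero_add 0) rfl rfl rfl rfl rfl, hg, hf]
  simp

theorem comp_sub_comp_mem {X Y Z : C.Obj} {g g' : C.cocycles Y Z 0} {f f' : C.cocycles X Y 0}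
    (hg : g.1 - g'.1 ∈ C.coboundaries Y Z 0) (hf : f.1 - f'.1 ∈ C.coboundaries X Y 0) :
    C.comp (zero_add 0) g.1 f.1 - C.comp (zero_add 0) g'.1 f'.1 ∈ C.coboundaries X Z 0 := by
  obtain ⟨a, ha⟩ := hg
  obtain ⟨b, hb⟩ := hf
  have hg' : C.d 0 (0 + 1) rfl g'.1 = 0 := g'.2
  have hf' : C.d 0 (0 + 1) rfl f.1 = 0 := f.2
  refine ⟨C.comp (add_zero (0 - 1)) a f.1 + C.comp (zero_add (0 - 1)) g'.1 b, ?_⟩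
  rw [map_add, C.leibniz (add_zero (0 - 1)) (sub_add_cancel 0 1) rfl (sub_add_cancel 0 1)
      (zero_add 0) (by norm_num),
    C.leibniz (zero_add (0 - 1)) rfl (sub_add_cancel 0 1) (sub_add_cancel 0 1) (by norm_num)
      (zero_add 0), ha, hb, hf', hg']
  simp [koszulSign_zero]

variable (C)

/-- The objects of the category `H⁰(C)`. -/
structure H0 where
  obj : C.Obj

variable {C}

/-- The category `H⁰(C)`. -/
instance : Category.{u} (H0 C) where
  Hom X Y := C.Cohomology X.obj Y.obj 0
  id X := Submodule.Quotient.mk ⟨C.one X.obj, one_mem_cocycles X.obj⟩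
  comp := Quotient.map₂ (fun f g => ⟨C.comp (zero_add 0) g.1 f.1, comp_mem_cocycles g f⟩) (by
    intro f f' hf g g' hg
    have hf' := (Submodule.quotientRel_def _).1 hf
    have hg' := (Submodule.quotientRel_def _).1 hg
    exact (Submodule.quotientRel_def _).2 (comp_sub_comp_mem hg' hf'))
  id_comp f := by
    induction f using Quotient.inductionOn
    exact congrArg Submodule.Quotient.mk (Subtype.ext (C.comp_one _))
  comp_id f := by
    induction f using Quotient.inductionOn
    exact congrArg Submodule.Quotient.mk (Subtype.ext (C.one_comp _))
  assoc f g h := by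
    induction f using Quotient.inductionOn
    induction g using Quotient.inductionOn
    induction h using Quotient.inductionOn
    exact congrArg Submodule.Quotient.mk (Subtype.ext (C.assoc _ _ _ _ _ _ _).symm)

namespace DGFunctor

/-- The map induced by a dg functor on closed morphisms. -/
def mapCocycles (F : DGFunctor C D) (X Y : C.Obj) (n : ℤ) :
    C.cocycles X Y n →ₗ[k] D.cocycles (F.obj X) (F.obj Y) n :=
  (F.map n).restrict fun f hf => by
    have hf' : C.d n (n + 1) rfl f = 0 := hf
    change D.d n (n + 1) rfl (F.map n f) = 0
    rw [← F.map_d, hf', map_zero]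

/-- The map induced by a dg functor on the cohomology of the complexes of morphisms. -/
def mapCohomology (F : DGFunctor C D) (X Y : C.Obj) (n : ℤ) :
    C.Cohomology X Y n →ₗ[k] D.Cohomology (F.obj X) (F.obj Y) n :=
  Submodule.mapQ _ _ (F.mapCocycles X Y n) (by
    rintro f ⟨a, ha⟩
    exact ⟨F.map (n - 1) a, by rw [← F.map_d, ha]; rfl⟩)

/-- The functor `H⁰(F)`. -/
def mapH0 (F : DGFunctor C D) : H0 C ⥤ H0 D where
  obj X := ⟨F.obj X.obj⟩
  map {X Y} f := F.mapCohomology X.obj Y.obj 0 f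
  map_id X := congrArg Submodule.Quotient.mk (Subtype.ext (F.map_one _))
  map_comp f g := by
    induction f using Quotient.inductionOn
    induction g using Quotient.inductionOn
    exact congrArg Submodule.Quotient.mk (Subtype.ext (F.map_comp _ _ _))

/-- Quasi-equivalences: quasi-isomorphisms on all complexes of morphisms that induce an
equivalence on `H⁰`. They are the weak equivalences of the Tabuada model structure. -/
def IsQuasiEquivalence (F : DGFunctor C D) : Prop :=
  (∀ (X Y : C.Obj) (n : ℤ), Function.Bijective (F.mapCohomology X Y n)) ∧ F.mapH0.IsEquivalence

/-- Fibrations of the Tabuada model structure: degreewise surjective on all complexes of morphisms,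
and every isomorphism `H⁰(F)(x) ≅ y'` in `H⁰(D)` is the image of an isomorphism `x ≅ y` in
`H⁰(C)`. -/
def IsFibration (F : DGFunctor C D) : Prop :=
  (∀ (X Y : C.Obj) (n : ℤ), Function.Surjective (F.map n : C.Hom X Y n →ₗ[k] _)) ∧
    ∀ (x : H0 C) (y' : H0 D) (v : F.mapH0.obj x ≅ y'),
      ∃ (y : H0 C) (e : F.mapH0.obj y = y') (u : x ≅ y), F.mapH0.map u.hom ≫ eqToHom e = v.hom

end DGFunctor

variable (C)

/-- Cofibrant objects of the Tabuada model structure: the dg functor from the empty dg category to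
`C` has the left lifting property with respect to all acyclic fibrations `p`. (The upper half of
a lifting square that starts with the empty dg category carries no data.) -/
def IsCofibrant : Prop :=
  ∀ (A B : DGCat k) (p : DGFunctor A B), p.IsFibration → p.IsQuasiEquivalence →
    ∀ g : DGFunctor C B, ∃ h : DGFunctor C A, h.comp p = g

end Cohomology

end DGCat

/-!
The embedding of `cohDG C D` into `cohAInf C D` is the identity on the complexes of morphisms, so
only the essential surjectivity of `H⁰` needs an argument: every `A∞`-functor `F : C ⟶ D` has to be
isomorphic in `H⁰` to a dg functor.

From `F` one builds a dg category `rectification F` with the objects of `C`. A morphism `X ⟶ X'` in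
it is a pair of a morphism `f : X ⟶ X'` of `C` and a cochain `Φ` on the chains of `C` that end in
`X` (the empty one included) with values in `D(F -, F X')`. The value of `Φ` at the empty chain is a
morphism `F X ⟶ F X'`; the other values form a homotopy that compares it with the action of `f`. The
differential and the composition are `d(f, Φ) = (df, δΦ + F · f)` and
`(f', Φ')(f, Φ) = (f' f, Φ' · f + Φ'[] ∘ Φ)`. That this is a dg category rests on the Leibniz rule
`diff_act`, which contains the Maurer-Cartan equation of `F` through `diff_tw`.

The complexes of cochains `Φ` are acyclic: evaluation at the chains `[id|c]` is a contraction
(`insertOne_diff`). Hence the projection `rectification F ⟶ C` is both a fibration and a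
quasi-equivalence, and it has a section if `C` is cofibrant. If `f ↦ (f, Φ_f)` is a section, then
`G f = Φ_f[]` is a dg functor, and `Ψ[] = id`, `Ψ[f|c] = -(-1)^|f| Φ_f[id|c]` is a closed coherent
natural transformation from `F` to `G` (`twistedDiff_transformation`).

Finally `Ψ` is the sum of the unit of the cup product and of a cochain that vanishes on empty chains.
The geometric series for the inverse of `Ψ` is finite on each chain, so that `Ψ` is invertible
(`exists_cup_inverse`), and the inverse of a closed invertible morphism is closed. Therefore `F` and
`G` are isomorphic.
-/

namespace DGCat

variable {k : Type u} [Field k] {C D : DGCat k}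

/-! ### Cochains on the chains that end in a fixed object -/

/-- Families of functions from the chains in `C` that end in `X` to the graded morphisms of `D`
into `Y`, contravariant in the source through `F`. -/
abbrev RightCochain (F : AInfFunctor C D) (X : C.Obj) (Y : D.Obj) : Type u :=
  ∀ ⦃W : C.Obj⦄, Chain C W X → ∀ q : ℤ, D.Hom (F.obj W) Y q

theorem comp_index_right {X Y Z : D.Obj} {p : ℤ} (g : D.Hom Y Z p) (f : ∀ n, D.Hom X Y n)
    {b b' r : ℤ} (h : p + b = r) (h' : p + b' = r) :
    D.comp h g (f b) = D.comp h' g (f b') := by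
  obtain rfl : b = b' := by omega
  rfl

namespace RightCochain

variable {F : AInfFunctor C D} {X X' : C.Obj} {Y Y' : D.Obj}

variable (F X Y) in
/-- The multilinear cochains of degree `p` on the chains that end in `X`. They have to vanish if
one of the morphisms of the chain other than the last applied one is an identity; no such condition
is imposed on the last applied morphism, so that evaluation at the chains `[id|c]` can serve as a
contraction. -/
def cochains (p : ℤ) : Submodule k (RightCochain F X Y) where
  carrier := {Φ | (∀ ⦃W : C.Obj⦄ (c : Chain C W X) (q : ℤ), q ≠ p + c.deg → Φ c q = 0) ∧
    (∀ (W : C.Obj) (q : ℤ), Chain.IsMultilinear (fun c : Chain C W X => Φ c q)) ∧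
    ∀ (W Z : C.Obj) (n q : ℤ) (g : C.Hom Z X n),
      Chain.IsNormalized (fun c : Chain C W Z => Φ (Chain.cons g c) q)}
  zero_mem' := ⟨fun _ _ _ _ => rfl, fun _ _ _ _ _ _ _ _ _ _ => by simp,
    fun _ _ _ _ _ _ _ _ => rfl⟩
  add_mem' := by
    rintro Ψ Φ ⟨h₁, h₂, h₃⟩ ⟨h₁', h₂', h₃'⟩
    refine ⟨fun W c q hq => ?_, fun W q V Z n v u a f f' => ?_, fun W Z n q g V v u => ?_⟩
    · simp [h₁ c q hq, h₁' c q hq]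
    · have h₅ := h₂ W q v u a f f'
      have h₆ := h₂' W q v u a f f'
      simp only [Pi.add_apply] at h₅ h₆ ⊢
      rw [h₅, h₆]; module
    · have h₅ := h₃ W Z n q g v u
      have h₆ := h₃' W Z n q g v u
      simp only [Pi.add_apply] at h₅ h₆ ⊢
      rw [h₅, h₆, add_zero]
  smul_mem' := by
    rintro b Ψ ⟨h₁, h₂, h₃⟩
    refine ⟨fun W c q hq => ?_, fun W q V Z n v u a f f' => ?_, fun W Z n q g V v u => ?_⟩
    · simp [h₁ c q hq]
    · have h₅ := h₂ W q v u a f f'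
      simp only [Pi.smul_apply] at h₅ ⊢
      rw [h₅]; module
    · have h₅ := h₃ W Z n q g v u
      simp only [Pi.smul_apply] at h₅ ⊢
      rw [h₅, smul_zero]

/-- The cup product `Φ ∪ F` of a cochain of degree `p` with the twisting cochain of `F`. -/
def cupTw (p : ℤ) (Φ : RightCochain F X Y) : RightCochain F X Y :=
  fun _ c q => Chain.splits c (fun _ v u => koszulSign k (1 * v.deg) •
    D.comp (add_sub_cancel (p + v.deg) q) (Φ v (p + v.deg)) (F.tw u (q - (p + v.deg))))

/-- The differential `d_D ∘ Φ - (-1)^p Φ ∘ b - (-1)^p Φ ∪ F` of a cochain of degree `p`. -/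
def diff (p : ℤ) : RightCochain F X Y →ₗ[k] RightCochain F X Y where
  toFun Φ := fun _ c q => D.d (q - 1) q (sub_add_cancel q 1) (Φ c (q - 1)) -
    koszulSign k p • Chain.bar c (fun c' => Φ c' q) - koszulSign k p • cupTw p Φ c q
  map_add' Φ Φ' := by
    funext W c q
    simp only [cupTw, Pi.add_apply, map_add, Chain.bar_add, LinearMap.add_apply, smul_add,
      Chain.splits_add]
    module
  map_smul' a Φ := by
    funext W c q
    simp only [cupTw, Pi.smul_apply, map_smul, Chain.bar_smul, LinearMap.smul_apply,
      smul_comm _ a, Chain.splits_smul, RingHom.id_apply]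
    module

theorem diff_apply (p : ℤ) (Φ : RightCochain F X Y) {W : C.Obj} (c : Chain C W X) (q : ℤ) :
    diff p Φ c q = D.d (q - 1) q (sub_add_cancel q 1) (Φ c (q - 1)) -
      koszulSign k p • Chain.bar c (fun c' => Φ c' q) - koszulSign k p • cupTw p Φ c q := rfl

/-- The right action of a morphism `f : X ⟶ X'` of degree `n` on cochains,
`(Φ · f)[g|…] = (-1)^n Φ[f g|…]` and `(Φ · f)[] = 0`. -/
def act {n : ℤ} (Φ : RightCochain F X' Y) (f : C.Hom X X' n) : RightCochain F X Y :=
  fun _ c q => Chain.merge f c (fun c' => Φ c' q)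

/-- Postcomposition with a homogeneous morphism of `D`. -/
def post {p : ℤ} (g : D.Hom Y Y' p) (Φ : RightCochain F X Y) : RightCochain F X Y' :=
  fun _ c q => D.comp (add_sub_cancel p q) g (Φ c (q - p))

/-- The cochain `c ↦ Φ[id|c]`, the contraction of the complex of cochains. -/
def insertOne (Φ : RightCochain F X Y) : RightCochain F X Y :=
  fun _ c q => Φ (Chain.cons (C.one X) c) q

variable (F X) in
/-- The cochain whose value at the empty chain is the identity, and which vanishes on all other
chains. -/
def unit : RightCochain F X (F.obj X) := fun _ c => unitCochain F.obj c

variable (F X) in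
/-- The twisting cochain of `F`, restricted to the chains that end in `X`. -/
def tw : RightCochain F X (F.obj X) := fun _ c => F.tw c

theorem act_nil {n : ℤ} (Φ : RightCochain F X' Y) (f : C.Hom X X' n) (q : ℤ) :
    act Φ f Chain.nil q = 0 := rfl

theorem act_cons {n m : ℤ} (Φ : RightCochain F X' Y) (f : C.Hom X X' n) {W Z : C.Obj}
    (g : C.Hom Z X m) (c : Chain C W Z) (q : ℤ) :
    act Φ f (Chain.cons g c) q = koszulSign k n • Φ (Chain.cons (C.comp rfl f g) c) q := rfl

theorem act_add_left {n : ℤ} (Φ Φ' : RightCochain F X' Y) (f : C.Hom X X' n) :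
    act (Φ + Φ') f = act Φ f + act Φ' f := by
  funext W c q
  exact Chain.merge_add ..

theorem act_smul_left {n : ℤ} (a : k) (Φ : RightCochain F X' Y) (f : C.Hom X X' n) :
    act (a • Φ) f = a • act Φ f := by
  funext W c q
  exact (Chain.map_merge (a • LinearMap.id : D.Hom (F.obj W) Y q →ₗ[k] _) f c _).symm

theorem act_zero_left {n : ℤ} (f : C.Hom X X' n) : act (0 : RightCochain F X' Y) f = 0 := by
  simpa using act_smul_left (0 : k) (0 : RightCochain F X' Y) f

theorem act_add_right {n p : ℤ} {Φ : RightCochain F X' Y} (hΦ : Φ ∈ cochains F X' Y p)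
    (f f' : C.Hom X X' n) : act Φ (f + f') = act Φ f + act Φ f' := by
  funext W c q
  cases c with
  | nil => simp [act_nil]
  | cons g c =>
    have h := (hΦ.2.1 _ q).lin 1 (C.comp rfl f g) (C.comp rfl f' g) c
    simp only [one_smul] at h
    simp only [Pi.add_apply, act_cons, map_add, LinearMap.add_apply, h, smul_add]

theorem act_smul_right {n p : ℤ} {Φ : RightCochain F X' Y} (hΦ : Φ ∈ cochains F X' Y p)
    (a : k) (f : C.Hom X X' n) : act Φ (a • f) = a • act Φ f := by
  funext W c q
  cases c with
  | nil => simp [act_nil]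
  | cons g c =>
    have h := (hΦ.2.1 _ q).lin a (C.comp rfl f g) 0 c
    simp only [add_zero, (hΦ.2.1 _ q).zero] at h
    simp only [Pi.smul_apply, act_cons, map_smul, LinearMap.smul_apply, h]
    module

theorem act_zero_right {n p : ℤ} {Φ : RightCochain F X' Y} (hΦ : Φ ∈ cochains F X' Y p) :
    act Φ (0 : C.Hom X X' n) = 0 := by
  simpa using act_smul_right hΦ (0 : k) (0 : C.Hom X X' n)

theorem act_act {p q r : ℤ} (h : p + q = r) {X'' : C.Obj} (Φ : RightCochain F X'' Y)
    (f : C.Hom X' X'' p) (g : C.Hom X X' q) : act (act Φ f) g = act Φ (C.comp h f g) := by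
  subst h
  funext W c s
  cases c with
  | nil => rfl
  | cons e c =>
    rw [act_cons, act_cons, act_cons, C.assoc rfl rfl rfl (add_assoc _ _ _).symm,
      Chain.cons_comp (add_assoc _ _ _).symm rfl, koszulSign_add]
    module

theorem post_act {p n : ℤ} (g : D.Hom Y Y' p) (Φ : RightCochain F X' Y) (f : C.Hom X X' n) :
    post g (act Φ f) = act (post g Φ) f := by
  funext W c q
  exact Chain.map_merge (D.comp (add_sub_cancel p q) g) f c _

theorem act_one {p : ℤ} (Φ : RightCochain F X Y) {W Z : C.Obj} (g : C.Hom Z X p)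
    (c : Chain C W Z) : act Φ (C.one X) (Chain.cons g c) = Φ (Chain.cons g c) := by
  funext q
  rw [act_cons, Chain.cons_comp rfl (zero_add _), C.one_comp, koszulSign_zero, one_smul]

theorem act_unit {n : ℤ} (f : C.Hom X X' n) : act (unit F X') f = 0 := by
  funext W c q
  cases c with
  | nil => rfl
  | cons g c => simp [act_cons, unit, unitCochain]

theorem post_one (Φ : RightCochain F X Y) : post (D.one Y) Φ = Φ := by
  funext W c q
  have h := single_one_comp (fun n => Φ c n) (add_sub_cancel 0 q) rfl
  rwa [Pi.single_eq_same] at h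

theorem post_post {p p' r : ℤ} (h : p + p' = r) {Y'' : D.Obj} (g : D.Hom Y' Y'' p)
    (g' : D.Hom Y Y' p') (Φ : RightCochain F X Y) :
    post g (post g' Φ) = post (D.comp h g g') Φ := by
  subst h
  funext W c q
  have e : p' + (q - (p + p')) = q - p := by ring
  rw [post, post, post, D.assoc rfl _ e (add_sub_cancel _ _)]
  congr 1
  exact comp_index_right g' (fun n => Φ c n) _ _

theorem post_add {p : ℤ} (g : D.Hom Y Y' p) (Φ Φ' : RightCochain F X Y) :
    post g (Φ + Φ') = post g Φ + post g Φ' := by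
  funext W c q
  simp [post]

theorem post_smul {p : ℤ} (g : D.Hom Y Y' p) (a : k) (Φ : RightCochain F X Y) :
    post g (a • Φ) = a • post g Φ := by
  funext W c q
  simp [post]

theorem add_post {p : ℤ} (g g' : D.Hom Y Y' p) (Φ : RightCochain F X Y) :
    post (g + g') Φ = post g Φ + post g' Φ := by
  funext W c q
  simp [post]

theorem smul_post {p : ℤ} (g : D.Hom Y Y' p) (a : k) (Φ : RightCochain F X Y) :
    post (a • g) Φ = a • post g Φ := by
  funext W c q
  simp [post]

theorem diff_nil (p q : ℤ) (Φ : RightCochain F X Y) :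
    diff p Φ Chain.nil q = D.d (q - 1) q (sub_add_cancel q 1) (Φ Chain.nil (q - 1)) := by
  rw [diff_apply, cupTw, Chain.splits_nil, F.tw_nil, Chain.bar_nil]
  simp

theorem post_tw_nil : post (tw F X Chain.nil 1) (tw F X) = 0 := by
  funext W c q
  rw [post, tw, F.tw_nil, map_zero, LinearMap.zero_apply]
  rfl

/-- The Maurer-Cartan equation. -/
theorem diff_tw : diff 1 (tw F X) = 0 := by
  funext W c q
  have h : (del 1 F.tw + cup 1 1 F.tw F.tw) c q = 0 := by rw [F.maurerCartan]; rfl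
  refine Eq.trans ?_ h
  have e : cupTw 1 (tw F X) c q = cup 1 1 F.tw F.tw c q := rfl
  simp only [diff_apply, e, Pi.add_apply, del, koszulSign_one, tw]
  module

/-- Every cochain extends, by zero, to the chains that end in other objects. This reduces statements
about cochains on the chains that end in `X` to cochains on all chains. -/
theorem exists_extension {p : ℤ} {Φ : RightCochain F X Y} (hΦ : Φ ∈ cochains F X Y p) :
    ∃ A ∈ DGCat.cochains C D F.obj (fun _ => Y) p, Φ = fun W c q => A (X := W) (Y := X) c q := by
  classical
  refine ⟨fun _ Z c q => if h : Z = X then Φ (h ▸ c) q else 0,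
    ⟨fun W Z c q hq => ?_, fun W Z q => ?_⟩, ?_⟩
  · by_cases h : Z = X
    · subst h
      simpa using hΦ.1 c q hq
    · simp [h]
  · by_cases h : Z = X
    · subst h
      simpa using hΦ.2.1 W q
    · simp only [h, dite_false]
      intro _ _ _ _ _ _ _ _
      simp
  · funext W c q
    simp

theorem diff_restrict (p : ℤ) (A : RawCochain C D F.obj (fun _ => Y)) :
    diff p (fun W (c : Chain C W X) q => A c q : RightCochain F X Y) =
      fun W c q => (del p A - koszulSign k p • cup p 1 A F.tw) c q := rfl

theorem diff_diff {p r : ℤ} (h : p + 1 = r) {Φ : RightCochain F X Y}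
    (hΦ : Φ ∈ cochains F X Y p) : diff r (diff p Φ) = 0 := by
  obtain ⟨A, hA, rfl⟩ := exists_extension hΦ
  rw [diff_restrict, diff_restrict]
  have key : del r (del p A - koszulSign k p • cup p 1 A F.tw) -
      koszulSign k r • cup r 1 (del p A - koszulSign k p • cup p 1 A F.tw) F.tw = 0 := by
    have hs : koszulSign k r = -koszulSign k p := by
      rw [← h, koszulSign_add, koszulSign_one]; ring
    have e₁ := del_del h hA
    have e₃ := del_cup h h (show (1 : ℤ) + 1 = 2 by rfl) A F.tw
    have e₅ := cup_assoc h (show (1 : ℤ) + 1 = 2 by rfl) A F.tw F.tw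
    have e₈ : cup p 2 A (del 1 F.tw + cup 1 1 F.tw F.tw) = 0 := by
      rw [F.maurerCartan]
      simpa using cup_smul_right p 2 0 A (0 : RawCochain C D F.obj F.obj)
    rw [cup_add_right, ← e₅] at e₈
    have hsub : ∀ {a b : RawCochain C D F.obj (fun _ => Y)}, a - b = a + (-1 : k) • b := by
      intro a b; module
    simp only [hsub, del_add, del_smul, cup_add_left, cup_smul_left, e₁, e₃, hs]
    rw [eq_neg_of_add_eq_zero_left e₈]
    rcases koszulSign_cases k p with h | h <;> rw [h] <;> module
  rw [key]
  rfl

/-- The action of `f` commutes with `∪ F` up to the term of `(Φ ∪ F) · f` in which `Φ` is evaluated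
at the empty chain, as `Φ · f` vanishes there. -/
theorem cupTw_act {p n r : ℤ} (h : p + n = r) (Φ : RightCochain F X' Y) (f : C.Hom X X' n) :
    act (cupTw p Φ) f =
      act (post (Φ Chain.nil p) (tw F X')) f + koszulSign k n • cupTw r (act Φ f) := by
  subst h
  funext W c q
  simp only [Pi.add_apply, Pi.smul_apply]
  have e₁ : act (cupTw p Φ) f c q = Chain.merge f c (fun c' => cupTw p Φ c' q) := rfl
  simp only [cupTw] at e₁
  rw [e₁, Chain.merge_splits, cupTw, ← Chain.splits_smul]
  congr 1
  · refine congrArg (Chain.merge f c) (funext fun c' => ?_)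
    simp only [Chain.deg_nil, mul_zero, koszulSign_zero, one_smul, post, tw]
    exact comp_index D (fun n => Φ Chain.nil n) (fun n => F.tw c' n) _ _ (add_zero p)
  · refine Chain.splits_congr c fun V v u _ => ?_
    cases v with
    | nil => simp [Chain.merge_nil, act_nil]
    | cons g v =>
      rw [Chain.merge_cons]
      simp only [act_cons, map_smul, LinearMap.smul_apply]
      rw [comp_index D (fun n => Φ (Chain.cons (C.comp rfl f g) v) n) (fun n => F.tw u n) _
        (add_sub_cancel (p + n + (Chain.cons g v).deg) q)
        (by simp only [Chain.deg_cons]; ring)]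
      simp only [Chain.deg_cons, one_mul, koszulSign_add, koszulSign_sub]
      rcases koszulSign_cases k n with h | h <;> rw [h] <;> module

/-- The Leibniz rule for the action. The last term is due to the vanishing of `Φ · f` at the empty
chain. -/
theorem diff_act {p n r m : ℤ} (h : p + n = r) (hm : n + 1 = m) {Φ : RightCochain F X' Y}
    (hΦ : Φ ∈ cochains F X' Y p) (f : C.Hom X X' n) :
    diff r (act Φ f) = act (diff p Φ) f + koszulSign k p • act Φ (C.d n m hm f) +
      koszulSign k p • act (post (Φ Chain.nil p) (tw F X')) f := by
  subst hm
  funext W c q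
  have h₁ := congrFun (congrFun (congrFun (cupTw_act h Φ f) W) c) q
  have h₂ := Chain.merge_bar f c _ (hΦ.2.1 W q)
  have h₃ : act (diff p Φ) f c q = D.d (q - 1) q (sub_add_cancel q 1) (act Φ f c (q - 1)) -
      koszulSign k p • Chain.merge f c (fun c' => Chain.bar c' (fun c' => Φ c' q)) -
      koszulSign k p • act (cupTw p Φ) f c q := by
    have hsub : ∀ a b : D.Hom (F.obj W) Y q, a - b = a + (-1 : k) • b := by
      intro a b; module
    have hs : ∀ (a : k) (K : Chain C W X' → D.Hom (F.obj W) Y q),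
        Chain.merge f c (fun c' => a • K c') = a • Chain.merge f c K := fun a K =>
      (Chain.map_merge (a • LinearMap.id : D.Hom (F.obj W) Y q →ₗ[k] _) f c K).symm
    simp only [act, diff_apply, hsub, Chain.merge_add, hs, Chain.map_merge]
  have h₄ : ∀ (K : Chain C W X → D.Hom (F.obj W) Y q), koszulSign k r • Chain.bar c K =
      koszulSign k p • koszulSign k n • Chain.bar c K := by
    intro K; rw [← h, koszulSign_add, mul_smul]
  simp only [Pi.add_apply, Pi.smul_apply] at h₁ ⊢
  rw [h₃, h₁, diff_apply]
  have h₅ : Chain.bar c (fun c' => act Φ f c' q) = koszulSign k n •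
      (Chain.merge f c (fun c' => Chain.bar c' (fun c' => Φ c' q)) -
        act Φ (C.d n (n + 1) rfl f) c q) := by
    have h₆ : koszulSign k (n - 1) • Chain.bar c (fun c' => act Φ f c' q) =
      - (Chain.merge f c (fun c' => Chain.bar c' (fun c' => Φ c' q)) -
        act Φ (C.d n (n + 1) rfl f) c q) := eq_neg_of_add_eq_zero_right h₂
    rw [koszulSign_sub, koszulSign_one] at h₆
    rcases koszulSign_cases k n with h | h <;> rw [h] at h₆ ⊢
    · rwa [one_mul, neg_smul, one_smul, neg_inj, ← one_smul k (_ - _)] at h₆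
    · simpa using h₆
  rw [h₅, ← h, koszulSign_add]
  rcases koszulSign_cases k n with h | h <;> rcases koszulSign_cases k p with h' | h' <;>
    rw [h, h'] <;> module

theorem diff_post {p p' r s : ℤ} (h : p' + p = r) (hs : p' + 1 = s) (g : D.Hom Y Y' p')
    (Φ : RightCochain F X Y) :
    diff r (post g Φ) = post (D.d p' s hs g) Φ + koszulSign k p' • post g (diff p Φ) := by
  subst h hs
  funext W c q
  have h₁ : Chain.bar c (fun c' => post g Φ c' q) =
      D.comp (add_sub_cancel p' q) g (Chain.bar c (fun c' => Φ c' (q - p'))) :=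
    (Chain.map_bar (D.comp (add_sub_cancel p' q) g) c _).symm
  have h₂ : cupTw (p' + p) (post g Φ) c q =
      D.comp (add_sub_cancel p' q) g (cupTw p Φ c (q - p')) := by
    rw [cupTw, cupTw, Chain.map_splits (D.comp (add_sub_cancel p' q) g)]
    refine Chain.splits_congr c fun V v u _ => ?_
    rw [map_smul, post, D.assoc (add_sub_cancel _ _) _
      (show p' + p + v.deg - p' + (q - (p' + p + v.deg)) = q - p' by ring) (add_sub_cancel _ _)]
    congr 2
    exact comp_index D (fun n => Φ v n) (fun n => F.tw u n) _ _ (by ring)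
  have h₃ : D.d (q - 1) q (sub_add_cancel q 1) (post g Φ c (q - 1)) =
      post (D.d p' (p' + 1) rfl g) Φ c q + koszulSign k p' •
        D.comp (add_sub_cancel p' q) g (D.d _ _ (sub_add_cancel _ 1) (Φ c (q - p' - 1))) := by
    rw [post, D.leibniz _ rfl (show q - 1 - p' + 1 = q - p' by ring) _
      (show p' + 1 + (q - 1 - p') = q by ring) (add_sub_cancel p' q), post,
      d_index D (fun n => Φ c n) _ (sub_add_cancel (q - p') 1)]
    congr 1
    exact comp_index_right _ (fun n => Φ c n) _ _
  simp only [Pi.add_apply, Pi.smul_apply]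
  rw [diff_apply, h₁, h₂, h₃, post, post, diff_apply]
  simp only [map_sub, map_smul, koszulSign_add]
  module

theorem cupTw_one {p r : ℤ} (h : r + 1 = p) (Φ : RightCochain F X Y) {W : C.Obj}
    (c : Chain C W X) (q : ℤ) :
    cupTw p Φ (Chain.cons (C.one X) c) q =
      post (Φ Chain.nil p) (tw F X) (Chain.cons (C.one X) c) q - cupTw r (insertOne Φ) c q := by
  subst h
  have hsub : ∀ a b : D.Hom (F.obj W) Y q, a - b = a + (-1 : k) • b := by
    intro a b; module
  rw [cupTw, Chain.splits_cons, hsub, cupTw, ← Chain.splits_smul]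
  congr 1
  · simp only [Chain.deg_nil, mul_zero, koszulSign_zero, one_smul, post, tw]
    exact comp_index D (fun n => Φ Chain.nil n) (fun n => F.tw _ n) _ _ (add_zero _)
  · refine Chain.splits_congr c fun V v u _ => ?_
    rw [comp_index D (fun n => Φ (Chain.cons (C.one X) v) n) (fun n => F.tw u n) _
      (add_sub_cancel (r + v.deg) q) (by simp only [Chain.deg_cons]; ring)]
    simp only [Chain.deg_cons, one_mul, koszulSign_add, koszulSign_sub, koszulSign_zero,
      koszulSign_one, insertOne]
    module

/-- `insertOne` is a contracting homotopy, up to a sign, of the complex of cochains. -/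
theorem insertOne_diff {p r : ℤ} (h : r + 1 = p) {Φ : RightCochain F X Y}
    (hΦ : Φ ∈ cochains F X Y p) :
    insertOne (diff p Φ) = diff r (insertOne Φ) - koszulSign k p • Φ := by
  have hs : koszulSign k p = -koszulSign k r := by
    rw [← h, koszulSign_add, koszulSign_one]; ring
  funext W c q
  have h₁ : insertOne (diff p Φ) c q =
      D.d (q - 1) q (sub_add_cancel q 1) (insertOne Φ c (q - 1)) -
        koszulSign k p • Chain.bar (Chain.cons (C.one X) c) (fun c' => Φ c' q) -
        koszulSign k p • cupTw p Φ (Chain.cons (C.one X) c) q := rfl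
  have h₂ : Chain.bar (Chain.cons (C.one X) c) (fun c' => Φ c' q) =
      act Φ (C.one X) c q - Chain.bar c (fun c' => insertOne Φ c' q) := by
    rw [Chain.bar_cons, C.d_one, (hΦ.2.1 W q).zero, koszulSign_sub, koszulSign_zero,
      koszulSign_one]
    simp only [insertOne, act]
    module
  -- the two contributions of `Φ c`: the first one for non-empty chains, the second one for `c = []`
  have h₃ : act Φ (C.one X) c q + post (Φ Chain.nil p) (tw F X) (Chain.cons (C.one X) c) q =
      Φ c q := by
    cases c with
    | nil =>
      rw [act_nil, zero_add, post, tw, F.tw_one]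
      refine comp_single_one (fun n => Φ Chain.nil n) _ fun hq => hΦ.1 _ _ ?_
      simpa [Chain.deg] using hq
    | cons g c =>
      have h := F.tw_unital Chain.nil (Chain.cons g c) (by simp [Chain.length]) (q - p)
      rw [Chain.append] at h
      rw [act_one, post, tw, h, map_zero, add_zero]
  rw [h₁, h₂, cupTw_one h Φ]
  simp only [Pi.sub_apply, Pi.smul_apply]
  rw [← h₃, diff_apply, hs]
  module

theorem insertOne_mem {p r : ℤ} (h : r + 1 = p) {Φ : RightCochain F X Y}
    (hΦ : Φ ∈ cochains F X Y p) : insertOne Φ ∈ cochains F X Y r := by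
  refine ⟨fun W c q hq => hΦ.1 _ _ ?_, fun W q => (hΦ.2.1 W q).cons _, fun W Z n q g V v u => ?_⟩
  · simp only [Chain.deg_cons]; omega
  · exact hΦ.2.2 W X 0 q (C.one X) (Chain.cons g v) u

theorem unit_mem (F : AInfFunctor C D) (X : C.Obj) : unit F X ∈ cochains F X (F.obj X) 0 :=
  have h := unitCochain_mem F.obj
  ⟨fun _ c q => h.1.1 c q, fun W q => h.1.2 W X q, fun _ _ _ _ _ _ _ _ => rfl⟩

theorem tw_mem (F : AInfFunctor C D) (X : C.Obj) : tw F X ∈ cochains F X (F.obj X) 1 :=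
  ⟨fun _ c q => F.tw_mem.1 c q, fun W q => F.tw_mem.2 W X q,
    fun _ _ _ q g _ v u => F.tw_unital (Chain.cons g v) u (by simp [Chain.length]) q⟩

theorem post_mem {p p' r : ℤ} (h : p' + p = r) (g : D.Hom Y Y' p') {Φ : RightCochain F X Y}
    (hΦ : Φ ∈ cochains F X Y p) : post g Φ ∈ cochains F X Y' r := by
  refine ⟨fun W c q hq => ?_, fun W q V Z n v u a f f' => ?_, fun W Z n q e V v u => ?_⟩
  · rw [post, hΦ.1 c _ (by omega), map_zero]
  · have h := hΦ.2.1 W (q - p') v u a f f'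
    dsimp only at h ⊢
    simp only [post, h, map_add, map_smul]
  · have h := hΦ.2.2 W Z n (q - p') e v u
    dsimp only at h ⊢
    rw [post, h, map_zero]

theorem act_mem {p n r : ℤ} (h : p + n = r) {Φ : RightCochain F X' Y}
    (hΦ : Φ ∈ cochains F X' Y p) (f : C.Hom X X' n) : act Φ f ∈ cochains F X Y r := by
  refine ⟨fun W c q hq => ?_, fun W q V Z m v u a e e' => ?_, fun W Z m q g V v u => ?_⟩
  · cases c with
    | nil => rfl
    | cons g c =>
      rw [act_cons, hΦ.1 _ q, smul_zero]
      simp only [Chain.deg_cons] at hq ⊢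
      omega
  · cases v with
    | nil =>
      simp only [Chain.append, act_cons, map_add, map_smul, (hΦ.2.1 W q).lin]
      module
    | cons g v =>
      have h := hΦ.2.1 W q (Chain.cons (C.comp rfl f g) v) u a e e'
      simp only [Chain.append] at h
      simp only [Chain.append, act_cons, h]
      module
  · have h := hΦ.2.2 W Z _ q (C.comp rfl f g) v u
    dsimp only at h ⊢
    rw [act_cons, h, smul_zero]

/-- If an entry other than the head is an identity, only the decomposition right before that entry
contributes to `Φ ∪ F`. -/
theorem cupTw_append_one {p : ℤ} {Φ : RightCochain F X Y} (hΦ : Φ ∈ cochains F X Y p)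
    {V W Z : C.Obj} {n : ℤ} (g : C.Hom Z X n) (v : Chain C V Z) (u : Chain C W V) (q : ℤ) :
    cupTw p Φ (Chain.cons g (v.append (Chain.cons (C.one V) u))) q =
      koszulSign k (Chain.cons g v).deg •
        D.comp (add_sub_cancel (p + (Chain.cons g v).deg) q)
          (Φ (Chain.cons g v) (p + (Chain.cons g v).deg))
          (F.tw (Chain.cons (C.one V) u) (q - (p + (Chain.cons g v).deg))) := by
  have h₀ : F.tw (Chain.cons g (v.append (Chain.cons (C.one V) u))) = 0 := by
    funext q
    exact F.tw_unital (Chain.cons g v) u (by simp [Chain.length]) q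
  rw [cupTw, Chain.splits_cons, h₀, Pi.zero_apply, map_zero, smul_zero, zero_add,
    Chain.splits_one_right, one_mul]
  · intro U u V' v' w
    have h := hΦ.2.2 _ _ n (p + (Chain.cons g (v'.append (Chain.cons (C.one V') w))).deg) g v' w
    dsimp only at h ⊢
    rw [h, map_zero, LinearMap.zero_apply, smul_zero]
  · intro U V' v' u u' hu
    rw [F.tw_unital u u' hu, map_zero, smul_zero]

theorem diff_mem {p r : ℤ} (h : p + 1 = r) {Φ : RightCochain F X Y}
    (hΦ : Φ ∈ cochains F X Y p) : diff p Φ ∈ cochains F X Y r := by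
  refine ⟨?_, ?_, fun W Z n q g V v u => ?_⟩
  · obtain ⟨A, hA, rfl⟩ := exists_extension hΦ
    exact fun W c q => (sub_mem (del_mem h hA)
      (Submodule.smul_mem _ _ (cup_mem h hA F.tw_mem))).1 c q
  · obtain ⟨A, hA, rfl⟩ := exists_extension hΦ
    exact fun W q => (sub_mem (del_mem h hA)
      (Submodule.smul_mem _ _ (cup_mem h hA F.tw_mem))).2 W X q
  · have hm := hΦ.2.1 W q
    have hn := hΦ.2.2 W Z n q g
    have h₀ := hΦ.2.2 W Z n (q - 1) g v u
    have h₁ := hΦ.2.2 W Z (n + 1) q (C.d n (n + 1) rfl g) v u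
    dsimp only at h₀ h₁ ⊢
    rw [diff_apply, h₀, map_zero, cupTw_append_one hΦ, Chain.bar_cons, h₁]
    -- The composites of the identity with its two neighbours cancel; if `u` is
    -- empty, the term of `Φ ∪ F` that ends in `F[id]` takes the place of the second composite.
    cases u with
    | nil =>
      rw [F.tw_one, comp_single_one (fun n => Φ (Chain.cons g v) n) _ (hΦ.1 _ q)]
      cases v with
      | nil =>
        rw [Chain.append, Chain.bar_one_nil (hm.cons g), Chain.merge_cons,
          Chain.cons_comp _ (add_zero _), C.comp_one]
        simp only [Chain.deg_cons, Chain.deg_nil, add_zero, koszulSign_sub, koszulSign_one]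
        module
      | cons e v =>
        have h₂ := hΦ.2.2 W _ _ q (C.comp rfl g e) v Chain.nil
        dsimp only at h₂
        rw [Chain.bar_append_one_nil (hm.cons g) hn _ (by simp [Chain.length]), Chain.append,
          Chain.merge_cons, h₂, Chain.deg_cons g, koszulSign_add]
        module
    | cons f u =>
      have h₃ : ∀ q, F.tw (Chain.cons (C.one V) (Chain.cons f u)) q = 0 :=
        F.tw_unital Chain.nil (Chain.cons f u) (by simp [Chain.length])
      rw [h₃, map_zero, smul_zero]
      cases v with
      | nil =>
        rw [Chain.append, Chain.bar_one (hm.cons g) hn _ (by simp [Chain.length]),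
          Chain.merge_cons, Chain.cons_comp _ (add_zero _), C.comp_one, koszulSign_sub,
          koszulSign_one]
        module
      | cons e v =>
        have h₂ := hΦ.2.2 W _ _ q (C.comp rfl g e) v (Chain.cons f u)
        dsimp only at h₂
        rw [Chain.bar_append_one (hm.cons g) hn _ _ (by simp [Chain.length])
          (by simp [Chain.length]), Chain.append, Chain.merge_cons, h₂]
        module

end RightCochain

/-! ### The rectification of an `A∞`-functor -/

variable (F : AInfFunctor C D)

open RightCochain

/-- The rectification of an `A∞`-functor `F : C ⟶ D`, a dg category with the objects of `C`. A
morphism `X ⟶ X'` of degree `n` consists of a morphism `f` of `C` and of a cochain `Φ` on the chains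
that end in `X` with values in `D(F -, F X')`. The value of `Φ` at the empty chain is a morphism
`F X ⟶ F X'`, and the other values of `Φ` are a homotopy between its composition with `F` and the
action of `f`. A dg functor `C ⟶ rectification F` that lifts the identity amounts to a dg functor
`G : C ⟶ D` with a closed coherent natural transformation from `F` to `G` that consists of
identities in length `0`. -/
def rectification : DGCat k where
  Obj := C.Obj
  Hom X X' n := C.Hom X X' n × RightCochain.cochains F X (F.obj X') n
  d {X X'} n m h :=
    { toFun := fun e => (C.d n m h e.1, ⟨diff n e.2.1 + act (tw F X') e.1,
        add_mem (diff_mem h e.2.2) (act_mem (by omega) (tw_mem F X') e.1)⟩)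
      map_add' := fun e e' => Prod.ext (map_add _ _ _) (Subtype.ext (by
        change diff n (e.2.1 + e'.2.1) + act (tw F X') (e.1 + e'.1) =
          diff n e.2.1 + act (tw F X') e.1 + (diff n e'.2.1 + act (tw F X') e'.1)
        rw [map_add, act_add_right (tw_mem F X')]
        abel))
      map_smul' := fun a e => Prod.ext (map_smul _ _ _) (Subtype.ext (by
        change diff n (a • e.2.1) + act (tw F X') (a • e.1) =
          a • (diff n e.2.1 + act (tw F X') e.1)
        rw [map_smul, act_smul_right (tw_mem F X'), smul_add])) }
  one X := (C.one X, ⟨unit F X, unit_mem F X⟩)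
  comp {X Y Z p q r} h := LinearMap.mk₂ k
    (fun e' e => (C.comp h e'.1 e.1, ⟨act e'.2.1 e.1 + post (e'.2.1 Chain.nil p) e.2.1,
      add_mem (act_mem h e'.2.2 e.1) (post_mem h _ e.2.2)⟩))
    (fun a b e => Prod.ext (by simp) (Subtype.ext (by
      change act (a.2.1 + b.2.1) e.1 + post (a.2.1 Chain.nil p + b.2.1 Chain.nil p) e.2.1 =
        act a.2.1 e.1 + post (a.2.1 Chain.nil p) e.2.1 +
          (act b.2.1 e.1 + post (b.2.1 Chain.nil p) e.2.1)
      rw [act_add_left, add_post]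
      abel)))
    (fun a e' e => Prod.ext (by simp) (Subtype.ext (by
      change act (a • e'.2.1) e.1 + post (a • e'.2.1 Chain.nil p) e.2.1 =
        a • (act e'.2.1 e.1 + post (e'.2.1 Chain.nil p) e.2.1)
      rw [act_smul_left, smul_post, smul_add])))
    (fun e a b => Prod.ext (by simp) (Subtype.ext (by
      change act e.2.1 (a.1 + b.1) + post (e.2.1 Chain.nil p) (a.2.1 + b.2.1) =
        act e.2.1 a.1 + post (e.2.1 Chain.nil p) a.2.1 +
          (act e.2.1 b.1 + post (e.2.1 Chain.nil p) b.2.1)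
      rw [act_add_right e.2.2, post_add]
      abel)))
    (fun a e' e => Prod.ext (by simp) (Subtype.ext (by
      change act e'.2.1 (a • e.1) + post (e'.2.1 Chain.nil p) (a • e.2.1) =
        a • (act e'.2.1 e.1 + post (e'.2.1 Chain.nil p) e.2.1)
      rw [act_smul_right e'.2.2, post_smul, smul_add])))
  d_d {X X' n m l} h h' e := Prod.ext (C.d_d h h' e.1) (Subtype.ext (by
    change diff m (diff n e.2.1 + act (tw F X') e.1) + act (tw F X') (C.d n m h e.1) = 0
    rw [map_add, diff_diff h e.2.2, diff_act (by omega) h (tw_mem F X'), diff_tw,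
      koszulSign_one]
    rw [post_tw_nil, act_zero_left]
    module))
  one_comp {X Y p} e := Prod.ext (C.one_comp e.1) (Subtype.ext (by
    change act (unit F Y) e.1 + post (unitCochain F.obj Chain.nil 0) e.2.1 = e.2.1
    rw [act_unit, zero_add]
    exact post_one e.2.1))
  comp_one {X Y p} e := Prod.ext (C.comp_one e.1) (Subtype.ext (by
    change act e.2.1 (C.one X) + post (e.2.1 Chain.nil p) (unit F X) = e.2.1
    funext W c q
    cases c with
    | nil =>
      refine (zero_add _).trans (comp_single_one (fun n => e.2.1 Chain.nil n) _ fun hq =>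
        e.2.2.1 _ _ (by simpa [Chain.deg] using hq))
    | cons g c =>
      have h : post (e.2.1 Chain.nil p) (unit F X) (Chain.cons g c) q = 0 := map_zero _
      rw [Pi.add_apply, Pi.add_apply, Pi.add_apply, h, act_one, add_zero]))
  assoc {W X Y Z p q r a b s} h₁ h₂ h₃ h₄ x y z := Prod.ext (C.assoc h₁ h₂ h₃ h₄ x.1 y.1 z.1)
    (Subtype.ext (by
      change act (act x.2.1 y.1 + post (x.2.1 Chain.nil p) y.2.1) z.1 +
          post ((act x.2.1 y.1 + post (x.2.1 Chain.nil p) y.2.1) Chain.nil a) z.2.1 =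
        act x.2.1 (C.comp h₃ y.1 z.1) + post (x.2.1 Chain.nil p)
          (act y.2.1 z.1 + post (y.2.1 Chain.nil q) z.2.1)
      have h : (act x.2.1 y.1 + post (x.2.1 Chain.nil p) y.2.1) Chain.nil a =
          D.comp h₁ (x.2.1 Chain.nil p) (y.2.1 Chain.nil q) := by
        refine (zero_add _).trans ?_
        exact comp_index_right _ (fun n => y.2.1 Chain.nil n) _ _
      rw [h, act_add_left, act_act h₃, post_add, post_post h₁, post_act]
      abel))
  leibniz {X Y Z p q r p' q' r'} h hp hq hr h₁ h₂ g f :=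
    Prod.ext (C.leibniz h hp hq hr h₁ h₂ g.1 f.1) (Subtype.ext (by
      change diff r (act g.2.1 f.1 + post (g.2.1 Chain.nil p) f.2.1) +
          act (tw F Z) (C.comp h g.1 f.1) =
        act (diff p g.2.1 + act (tw F Z) g.1) f.1 +
            post ((diff p g.2.1 + act (tw F Z) g.1) Chain.nil p') f.2.1 +
          koszulSign k p • (act g.2.1 (C.d q q' hq f.1) +
            post (g.2.1 Chain.nil p) (diff q f.2.1 + act (tw F Y) f.1))
      have h : (diff p g.2.1 + act (tw F Z) g.1) Chain.nil p' =
          D.d p p' hp (g.2.1 Chain.nil p) := by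
        refine (add_zero _).trans ((diff_nil _ _ _).trans ?_)
        exact d_index D (fun n => g.2.1 Chain.nil n) _ _
      rw [h, map_add, diff_act ‹p + q = r› hq g.2.2, diff_post ‹p + q = r› hp, act_add_left,
        act_act ‹p + q = r›, post_add, post_act]
      module))

/-- The projection of the rectification onto `C`. -/
def rectificationProj : DGFunctor (rectification F) C where
  obj X := X
  map {X X' : C.Obj} n := LinearMap.fst k (C.Hom X X' n) (RightCochain.cochains F X (F.obj X') n)
  map_d _ _ := rfl
  map_one _ := rfl
  map_comp _ _ _ := rfl

/-- The complexes of cochains on the chains that end in a fixed object are acyclic. -/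
theorem RightCochain.exists_diff_eq {F : AInfFunctor C D} {X : C.Obj} {Y : D.Obj} {p r : ℤ}
    (h : r + 1 = p) {Φ : RightCochain F X Y} (hΦ : Φ ∈ RightCochain.cochains F X Y p)
    (hd : diff p Φ = 0) : ∃ Θ ∈ RightCochain.cochains F X Y r, diff r Θ = Φ := by
  refine ⟨koszulSign k p • insertOne Φ, Submodule.smul_mem _ _ (insertOne_mem h hΦ), ?_⟩
  have h₁ := insertOne_diff h hΦ
  rw [hd] at h₁
  rw [map_smul, sub_eq_zero.1 h₁.symm, smul_smul, koszulSign_mul_self, one_smul]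

theorem eq_zero_of_mem_cocycles {A : DGCat k} {X Y : A.Obj} {n : ℤ} {f : A.Hom X Y n}
    (hf : f ∈ A.cocycles X Y n) : A.d n (n + 1) rfl f = 0 := hf

/-- The kernel of the projection on morphisms consists of acyclic complexes of cochains, so the
projection is a quasi-isomorphism. -/
theorem mapCohomology_rectificationProj_bijective (X X' : C.Obj) (n : ℤ) :
    Function.Bijective ((rectificationProj F).mapCohomology X X' n) := by
  constructor
  · refine (injective_iff_map_eq_zero _).2 fun x hx => ?_
    obtain ⟨⟨⟨f, Φ, hΦ⟩, he⟩, rfl⟩ := Submodule.Quotient.mk_surjective _ x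
    obtain ⟨(a : C.Hom X X' (n - 1)), ha⟩ := (Submodule.Quotient.mk_eq_zero _).1 hx
    obtain rfl : C.d (n - 1) n (sub_add_cancel n 1) a = f := ha
    have he' : diff n Φ + act (tw F X') (C.d (n - 1) n (sub_add_cancel n 1) a) = 0 :=
      congrArg (fun e => e.2.1) (eq_zero_of_mem_cocycles he)
    have h₁ : (1 : ℤ) + (n - 1) = n := by ring
    have ht := act_mem h₁ (tw_mem F X') a
    -- `(f, Φ) - d(a, 0)` is the closed morphism `(0, Φ - F · a)`
    obtain ⟨Θ, hΘ, h⟩ := exists_diff_eq (sub_add_cancel n 1) (sub_mem hΦ ht) (by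
      rw [map_sub, diff_act h₁ (sub_add_cancel n 1) (tw_mem F X'), diff_tw, act_zero_left,
        post_tw_nil, act_zero_left, koszulSign_one]
      rw [← he']
      module)
    refine (Submodule.Quotient.mk_eq_zero _).2 ⟨(a, ⟨Θ, hΘ⟩), Prod.ext rfl (Subtype.ext ?_)⟩
    exact (congrArg (· + act (tw F X') a) h).trans (sub_add_cancel _ _)
  · intro y
    obtain ⟨⟨(f : C.Hom X X' n), hf⟩, rfl⟩ := Submodule.Quotient.mk_surjective _ y
    have hf' : C.d n (n + 1) rfl f = 0 := hf
    have h₁ : (1 : ℤ) + n = n + 1 := add_comm _ _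
    have ht := act_mem h₁ (tw_mem F X') f
    -- a primitive of the closed cochain `-F · f` completes `f` to a closed morphism
    obtain ⟨Θ, hΘ, h⟩ := exists_diff_eq rfl (neg_mem ht) (by
      rw [map_neg, diff_act h₁ rfl (tw_mem F X'), diff_tw, act_zero_left, hf',
        post_tw_nil, act_zero_left, act_zero_right (tw_mem F X')]
      simp)
    refine ⟨Submodule.Quotient.mk ⟨(f, ⟨Θ, hΘ⟩), Prod.ext hf' (Subtype.ext ?_)⟩, rfl⟩
    exact (congrArg (· + act (tw F X') f) h).trans (neg_add_cancel _)

theorem DGFunctor.fullyFaithful_mapH0 {A B : DGCat k} (P : DGFunctor A B)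
    (hP : ∀ (X Y : A.Obj) (n : ℤ), Function.Bijective (P.mapCohomology X Y n)) :
    P.mapH0.Full ∧ P.mapH0.Faithful :=
  ⟨⟨fun {X Y} f => (hP X.obj Y.obj 0).2 f⟩, ⟨fun {X Y} _ _ h => (hP X.obj Y.obj 0).1 h⟩⟩

theorem rectificationProj_isQuasiEquivalence : (rectificationProj F).IsQuasiEquivalence := by
  have h := mapCohomology_rectificationProj_bijective F
  obtain ⟨h₁, h₂⟩ := (rectificationProj F).fullyFaithful_mapH0 h
  have h₃ : (rectificationProj F).mapH0.EssSurj := ⟨fun Y => ⟨⟨Y.obj⟩, ⟨Iso.refl Y⟩⟩⟩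
  exact ⟨h, {}⟩

theorem rectificationProj_isFibration : (rectificationProj F).IsFibration := by
  obtain ⟨h₁, h₂⟩ := (rectificationProj F).fullyFaithful_mapH0
    (mapCohomology_rectificationProj_bijective F)
  refine ⟨fun X X' n f => ⟨(f, 0), rfl⟩, fun x y' v => ?_⟩
  refine ⟨⟨y'.obj⟩, rfl, (rectificationProj F).mapH0.preimageIso v, ?_⟩
  exact (Category.comp_id _).trans ((rectificationProj F).mapH0.map_preimage
    (X := x) (Y := ⟨y'.obj⟩) v.hom)

/-! ### Rectified functors -/

/-- A section of the projection of the rectification of `F`, in terms of its components: a dg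
functor that sends `f` to `(f, cochain n f)`. -/
structure RectificationSection where
  cochain : ∀ {X X' : C.Obj} (n : ℤ),
    C.Hom X X' n →ₗ[k] RightCochain.cochains F X (F.obj X') n
  cochain_d : ∀ {X X' : C.Obj} {n m : ℤ} (h : n + 1 = m) (f : C.Hom X X' n),
    (cochain m (C.d n m h f)).1 = diff n (cochain n f).1 + act (tw F X') f
  cochain_one : ∀ X : C.Obj, (cochain 0 (C.one X)).1 = unit F X
  cochain_comp : ∀ {X Y Z : C.Obj} {p q r : ℤ} (h : p + q = r) (g : C.Hom Y Z p)
    (f : C.Hom X Y q), (cochain r (C.comp h g f)).1 =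
      act (cochain p g).1 f + post ((cochain p g).1 Chain.nil p) (cochain q f).1

theorem IsCofibrant.nonempty_rectificationSection (hC : C.IsCofibrant) :
    Nonempty (RectificationSection F) := by
  obtain ⟨s, hs⟩ := hC _ _ _ (rectificationProj_isFibration F)
    (rectificationProj_isQuasiEquivalence F) ⟨id, fun _ => LinearMap.id, fun _ _ => rfl,
      fun _ => rfl, fun _ _ _ => rfl⟩
  obtain ⟨o, m, m_d, m_one, m_comp⟩ := s
  simp only [DGFunctor.comp, DGFunctor.mk.injEq] at hs
  obtain ⟨ho, hs⟩ := hs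
  -- once the map on objects is known to be the identity, the maps on morphisms can be compared
  obtain rfl : o = fun X => X := ho
  have hm : ∀ (X Y : C.Obj) (n : ℤ) (f : C.Hom X Y n), (m n f).1 = f := fun X Y n f =>
    LinearMap.congr_fun (congrFun (congrFun (congrFun (eq_of_heq hs) X) Y) n) f
  refine ⟨⟨fun {X X'} n => LinearMap.snd k (C.Hom X X' n) _ ∘ₗ m n, fun {X X' n p} h f => ?_,
    fun X => ?_, fun {X Y Z p q r} h g f => ?_⟩⟩
  · refine (congrArg (fun e => e.2.1) (m_d h f)).trans ?_
    change diff n (m n f).2.1 + act (tw F X') (m n f).1 = _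
    rw [hm]
    rfl
  · exact congrArg (fun e => e.2.1) (m_one X)
  · refine (congrArg (fun e => e.2.1) (m_comp h g f)).trans ?_
    change act (m p g).2.1 (m q f).1 + post ((m p g).2.1 Chain.nil p) (m q f).2.1 = _
    rw [hm]
    rfl

namespace RectificationSection

variable {F} (s : RectificationSection F)

/-- The dg functor given by the values at the empty chain of the components of a section. -/
def functor : DGFunctor C D where
  obj := F.obj
  map {X Y} n :=
    { toFun := fun f => (s.cochain n f).1 Chain.nil n
      map_add' := fun f f' => by rw [map_add]; rfl
      map_smul' := fun a f => by rw [map_smul]; rfl }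
  map_d {X Y n m} h f := by
    change (s.cochain m (C.d n m h f)).1 Chain.nil m = D.d n m h ((s.cochain n f).1 Chain.nil n)
    rw [s.cochain_d]
    refine (add_zero _).trans ((diff_nil _ _ _).trans ?_)
    exact d_index D (fun n' => (s.cochain n f).1 Chain.nil n') _ _
  map_one X := by
    change (s.cochain 0 (C.one X)).1 Chain.nil 0 = D.one (F.obj X)
    rw [s.cochain_one]
    exact Pi.single_eq_same (M := fun n => D.Hom (F.obj X) (F.obj X) n) 0 (D.one (F.obj X))
  map_comp {X Y Z p q r} h g f := by
    change (s.cochain r (C.comp h g f)).1 Chain.nil r = _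
    rw [s.cochain_comp]
    refine (zero_add _).trans ?_
    exact comp_index_right _ (fun n' => (s.cochain q f).1 Chain.nil n') _ _

/-- The coherent natural transformation from `F` to the dg functor of a section: it consists of
identities in length `0`, and its value at `[f|c]` is, up to a sign, the value at `[id|c]` of the
component of the section at `f`. -/
def transformation : RawCochain C D F.obj F.obj
  | X, _, Chain.nil => Pi.single 0 (D.one (F.obj X))
  | _, _, Chain.cons (n := n) f c => fun q => koszulSign k (n - 1) • insertOne (s.cochain n f).1 c q

theorem transformation_nil (X : C.Obj) :
    s.transformation (Chain.nil : Chain C X X) = Pi.single 0 (D.one (F.obj X)) := rfl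

theorem transformation_cons {X Y Z : C.Obj} {n : ℤ} (f : C.Hom Y Z n) (c : Chain C X Y) (q : ℤ) :
    s.transformation (Chain.cons f c) q =
      koszulSign k (n - 1) • insertOne (s.cochain n f).1 c q := rfl

theorem transformation_mem : s.transformation ∈ normalizedCochains C D F.obj F.obj 0 := by
  refine ⟨⟨fun X Y c q hq => ?_, fun X Y q W Z n v u a f f' => ?_⟩, fun X Y q W v u => ?_⟩
  · cases c with
    | nil => exact Pi.single_eq_of_ne (by simpa [Chain.deg] using hq) _
    | cons f c =>
      rename_i n
      rw [transformation_cons, (insertOne_mem (sub_add_cancel _ 1) (s.cochain n f).2).1,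
        smul_zero]
      simp only [Chain.deg_cons] at hq
      omega
  · cases v with
    | nil =>
      simp only [Chain.append, transformation_cons, insertOne, map_add, map_smul,
        Submodule.coe_add, Submodule.coe_smul, Pi.add_apply, Pi.smul_apply]
      module
    | cons g v =>
      rename_i m
      have h := (insertOne_mem (sub_add_cancel _ 1) (s.cochain m g).2).2.1 X q v u a f f'
      dsimp only at h
      simp only [Chain.append, transformation_cons, h]
      module
  · cases v with
    | nil =>
      simp only [Chain.append, transformation_cons, s.cochain_one]
      exact smul_zero _
    | cons g v =>
      rename_i V m
      have h := (s.cochain m g).2.2.2 X V 0 q (C.one V) v u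
      dsimp only at h
      simp only [Chain.append, transformation_cons, insertOne]
      rw [h, smul_zero]

/-- The contraction applied to the compatibility of the section with differentials. -/
theorem insertOne_cochain_d {X X' : C.Obj} {n : ℤ} (f : C.Hom X X' n) {W : C.Obj}
    (c : Chain C W X) (q : ℤ) :
    insertOne (s.cochain (n + 1) (C.d n (n + 1) rfl f)).1 c q =
      diff (n - 1) (insertOne (s.cochain n f).1) c q - koszulSign k n • (s.cochain n f).1 c q +
        koszulSign k n • F.tw (Chain.cons f c) q := by
  have h₁ := congrFun (congrFun (congrFun
    (insertOne_diff (sub_add_cancel n 1) (s.cochain n f).2) W) c) q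
  have h₂ : insertOne (act (tw F X') f) c q = koszulSign k n • F.tw (Chain.cons f c) q := by
    rw [insertOne, act_cons, Chain.cons_comp rfl (add_zero _), C.comp_one, tw]
  rw [s.cochain_d, ← h₂]
  exact congrArg (· + _) h₁

/-- The compatibility of the section with compositions, evaluated at the chains `[id|c]`. -/
theorem merge_transformation {X Y : C.Obj} {n : ℤ} (f : C.Hom X Y n) {W : C.Obj}
    (c : Chain C W X) (q : ℤ) :
    Chain.merge f c (fun c' => s.transformation c' q) =
      post ((s.cochain n f).1 Chain.nil n) (fun _ c => s.transformation c) c q - (s.cochain n f).1 c q := by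
  cases c with
  | nil =>
    rw [Chain.merge_nil, eq_comm, sub_eq_zero, post]
    exact comp_single_one (fun m => (s.cochain n f).1 Chain.nil m) _ fun hq =>
      (s.cochain n f).2.1 _ _ (by simpa [Chain.deg] using hq)
  | cons g c =>
    rename_i Z m
    have h : insertOne (s.cochain (n + m) (C.comp rfl f g)).1 c q =
        koszulSign k m • (s.cochain n f).1 (Chain.cons g c) q +
          post ((s.cochain n f).1 Chain.nil n) (insertOne (s.cochain m g).1) c q := by
      rw [s.cochain_comp rfl f g]
      change act (s.cochain n f).1 g (Chain.cons (C.one Z) c) q +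
        post ((s.cochain n f).1 Chain.nil n) (insertOne (s.cochain m g).1) c q = _
      rw [act_cons, Chain.cons_comp rfl (add_zero _), C.comp_one]
    change _ = D.comp (add_sub_cancel n q) ((s.cochain n f).1 Chain.nil n)
      (s.transformation (Chain.cons g c) (q - n)) - _
    rw [Chain.merge_cons, transformation_cons, h, post, transformation_cons]
    simp only [koszulSign_add, koszulSign_sub, koszulSign_one, map_smul]
    rcases koszulSign_cases k n with h | h <;> rcases koszulSign_cases k m with h' | h' <;>
      rw [h, h'] <;> module

/-- The closedness of the transformation, for a twisting cochain `T` whose only component is the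
dg functor of the section. -/
theorem del_transformation (T : RawCochain C D F.obj F.obj)
    (hT₀ : ∀ X : C.Obj, T (Chain.nil : Chain C X X) = 0)
    (hT₁ : ∀ {X Y : C.Obj} {n : ℤ} (f : C.Hom X Y n),
      T (Chain.cons f Chain.nil) = Pi.single n ((s.cochain n f).1 Chain.nil n))
    (hT₂ : ∀ {X Y Z W : C.Obj} {n m : ℤ} (f : C.Hom Z W n) (g : C.Hom Y Z m) (c : Chain C X Y),
      T (Chain.cons f (Chain.cons g c)) = 0) :
    del 0 s.transformation + cup 1 0 T s.transformation -
      cup 0 1 s.transformation F.tw = 0 := by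
  funext X Y c q
  simp only [Pi.sub_apply, Pi.add_apply, Pi.zero_apply]
  cases c with
  | nil =>
    have h₁ : cup 1 0 T s.transformation (Chain.nil : Chain C X X) q = 0 := by
      rw [cup, Chain.splits_nil, hT₀]
      simp
    have h₂ : cup 0 1 s.transformation F.tw (Chain.nil : Chain C X X) q = 0 := by
      rw [cup, Chain.splits_nil, F.tw_nil, map_zero, smul_zero]
    have h₃ : del 0 s.transformation (Chain.nil : Chain C X X) q = 0 := by
      rw [del, transformation_nil, Chain.bar_nil, d_single, D.d_one]
      simp
    rw [h₁, h₂, h₃, add_zero, sub_zero]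
  | cons f c =>
    rename_i Z n
    have h₁ : cup 1 0 T s.transformation (Chain.cons f c) q =
        post ((s.cochain n f).1 Chain.nil n) (fun _ c => s.transformation c) c q := by
      rw [cup, Chain.splits_cons, hT₀, Pi.zero_apply, map_zero,
        LinearMap.zero_apply, smul_zero, zero_add, Chain.splits_eq_right, zero_mul,
        koszulSign_zero, one_smul, hT₁]
      · rw [comp_index D (fun a => Pi.single n ((s.cochain n f).1 Chain.nil n) a)
          (fun b => s.transformation c b) _ (add_sub_cancel n q)
          (by simp [Chain.deg]), Pi.single_eq_same]
        rfl
      · intros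
        rw [hT₂, Pi.zero_apply, map_zero, LinearMap.zero_apply, smul_zero]
    have h₂ : cup 0 1 s.transformation F.tw (Chain.cons f c) q =
        F.tw (Chain.cons f c) q + cupTw (n - 1) (insertOne (s.cochain n f).1) c q := by
      rw [cup, Chain.splits_cons, transformation_nil]
      congr 1
      · simp only [Chain.deg_nil, mul_zero, koszulSign_zero, one_smul]
        exact single_one_comp (fun m => F.tw (Chain.cons f c) m) _ (add_zero 0)
      · refine Chain.splits_congr c fun V v u _ => ?_
        rw [comp_index D (fun m => s.transformation (Chain.cons f v) m) (fun m => F.tw u m) _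
          (add_sub_cancel (n - 1 + v.deg) q) (by simp only [Chain.deg_cons]; ring)]
        simp only [transformation_cons, map_smul, LinearMap.smul_apply, Chain.deg_cons, one_mul,
          koszulSign_add, smul_smul]
        rcases koszulSign_cases k (n - 1) with h | h <;> rw [h] <;> simp
    have h₃ : del 0 s.transformation (Chain.cons f c) q = D.d (q - 1) q (sub_add_cancel q 1)
          (s.transformation (Chain.cons f c) (q - 1)) -
        Chain.bar (Chain.cons f c) (fun c' => s.transformation c' q) := by
      rw [del, koszulSign_zero, one_smul]
    rw [h₁, h₂, h₃, Chain.bar_cons, s.merge_transformation]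
    simp only [transformation_cons, s.insertOne_cochain_d, diff_apply, Chain.bar_smul, map_smul,
      koszulSign_add, koszulSign_sub, koszulSign_one]
    rcases koszulSign_cases k n with h | h <;> rw [h] <;> module

theorem twistedDiff_transformation :
    twistedDiff F s.functor.toAInf 0 s.transformation = 0 := by
  have h := s.del_transformation s.functor.twist (fun _ => rfl) (fun _ => rfl) (fun _ _ _ => rfl)
  change (_ - koszulSign k 0 • cup 0 1 s.transformation F.tw : RawCochain C D F.obj F.obj) = 0
  rw [koszulSign_zero, one_smul]
  exact h

end RectificationSection

/-! ### Inverses for the cup product -/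

theorem Chain.splits_congr_of_length {M : Type u} [AddCommGroup M] {X Y : C.Obj}
    (c : Chain C X Y) {K K' : ∀ ⦃W : C.Obj⦄, Chain C W Y → Chain C X W → M}
    (h : ∀ ⦃W : C.Obj⦄ (v : Chain C W Y) (u : Chain C X W), v.length + u.length = c.length →
      K v u = K' v u) : splits c K = splits c K' := by
  induction c with
  | nil => exact h _ _ rfl
  | cons g c ih =>
    simp only [splits]
    rw [h _ _ (by simp [length]), ih fun W v u hvu => h _ _ (by simp [length, ← hvu]; ring)]

theorem Chain.length_append {X Y Z : C.Obj} (v : Chain C Y Z) (u : Chain C X Y) :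
    (v.append u).length = v.length + u.length := by
  induction v with
  | nil => simp [append, length]
  | cons g v ih => simp [append, length, ih]; ring

section Inverse

variable {φ : C.Obj → D.Obj}

theorem cup_congr_of_length {A A' N : RawCochain C D φ φ}
    (hN : ∀ X : C.Obj, N (Chain.nil : Chain C X X) = 0) {X Y : C.Obj} (c : Chain C X Y)
    (h : ∀ {W : C.Obj} (v : Chain C W Y), v.length < c.length → A v = A' v) :
    cup 0 0 A N c = cup 0 0 A' N c := by
  funext q
  refine Chain.splits_congr_of_length c fun W v u hvu => ?_
  cases u with
  | nil => simp [hN]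
  | cons f u => rw [h v (by simp only [Chain.length] at hvu; omega)]

/-- The partial sums of the geometric series `∑ (-1)^i N^i` for the cup product, which is the
inverse of the sum of `N` and the unit. -/
def geomApprox (N : RawCochain C D φ φ) : ℕ → RawCochain C D φ φ
  | 0 => unitCochain φ
  | m + 1 => unitCochain φ - cup 0 0 (geomApprox N m) N

theorem geomApprox_mem {N : RawCochain C D φ φ} (hN : N ∈ normalizedCochains C D φ φ 0) (m : ℕ) :
    geomApprox N m ∈ normalizedCochains C D φ φ 0 := by
  induction m with
  | zero => exact unitCochain_mem φ
  | succ m ih => exact sub_mem (unitCochain_mem φ) (cup_mem_normalized (add_zero 0) ih hN)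

theorem geomApprox_eq {N : RawCochain C D φ φ}
    (hN : ∀ X : C.Obj, N (Chain.nil : Chain C X X) = 0) {m : ℕ} {X Y : C.Obj} (c : Chain C X Y)
    (hc : c.length ≤ m) : geomApprox N m c = geomApprox N c.length c := by
  have step : ∀ (m : ℕ) {X Y : C.Obj} (c : Chain C X Y), c.length ≤ m →
      geomApprox N (m + 1) c = geomApprox N m c := by
    intro m
    induction m with
    | zero =>
      intro X Y c hc
      cases c with
      | nil =>
        funext q
        simp [geomApprox, cup, Chain.splits_nil, hN]
      | cons g c => simp [Chain.length] at hc
    | succ m ih =>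
      intro X Y c hc
      have h : cup 0 0 (geomApprox N (m + 1)) N c = cup 0 0 (geomApprox N m) N c :=
        cup_congr_of_length hN c fun v hv => ih v (by omega)
      exact congrArg (unitCochain φ c - ·) h
  induction m, hc using Nat.le_induction with
  | base => rfl
  | succ m hm ih => rw [step m c hm, ih]

/-- A cochain that consists of identities in length `0` has a left inverse of the same kind: on
chains of length `m`, take the `m`-th partial sum of the geometric series. -/
theorem exists_cup_eq_unit {Ψ : RawCochain C D φ φ} (hΨ : Ψ ∈ normalizedCochains C D φ φ 0)
    (h₀ : ∀ X : C.Obj, Ψ (Chain.nil : Chain C X X) = Pi.single 0 (D.one (φ X))) :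
    ∃ Θ ∈ normalizedCochains C D φ φ 0,
      (∀ X : C.Obj, Θ (Chain.nil : Chain C X X) = Pi.single 0 (D.one (φ X))) ∧
        cup 0 0 Θ Ψ = unitCochain φ := by
  have hm := sub_mem hΨ (unitCochain_mem φ)
  have hN : ∀ X : C.Obj, (Ψ - unitCochain φ) (Chain.nil : Chain C X X) = 0 := fun X => by
    change Ψ Chain.nil - Pi.single 0 (D.one (φ X)) = 0
    rw [h₀, sub_self]
  obtain ⟨N, rfl⟩ : ∃ N, Ψ = N + unitCochain φ := ⟨_, (sub_add_cancel _ _).symm⟩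
  rw [add_sub_cancel_right] at hm hN
  let Θ : RawCochain C D φ φ := fun _ _ c => geomApprox N c.length c
  have hΘ : Θ ∈ normalizedCochains C D φ φ 0 := by
    refine ⟨⟨fun X Y c q hq => (geomApprox_mem hm _).1.1 c q hq,
      fun X Y q W Z n v u a f f' => ?_⟩, fun X Y q W v u => (geomApprox_mem hm _).2 X Y q v u⟩
    have h := (geomApprox_mem hm (v.length + (u.length + 1))).1.2 X Y q v u a f f'
    simp only [Θ, Chain.length_append, Chain.length] at h ⊢
    exact h
  refine ⟨Θ, hΘ, fun X => rfl, ?_⟩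
  rw [cup_add_right, cup_unit_right hΘ.1]
  funext X Y c
  have h₁ : cup 0 0 Θ N c = cup 0 0 (geomApprox N c.length) N c :=
    cup_congr_of_length hN c fun v hv => (geomApprox_eq hN v hv.le).symm
  have h₂ : Θ c = unitCochain φ c - cup 0 0 (geomApprox N c.length) N c :=
    (geomApprox_eq hN c (Nat.le_succ c.length)).symm
  change cup 0 0 Θ N c + Θ c = _
  rw [h₁, h₂, add_sub_cancel]

/-- A cochain that consists of identities in length `0` is invertible for the cup product. -/
theorem exists_cup_inverse {Ψ : RawCochain C D φ φ} (hΨ : Ψ ∈ normalizedCochains C D φ φ 0)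
    (h₀ : ∀ X : C.Obj, Ψ (Chain.nil : Chain C X X) = Pi.single 0 (D.one (φ X))) :
    ∃ Θ ∈ normalizedCochains C D φ φ 0,
      cup 0 0 Θ Ψ = unitCochain φ ∧ cup 0 0 Ψ Θ = unitCochain φ := by
  obtain ⟨Θ, hΘ, hΘ₀, h⟩ := exists_cup_eq_unit hΨ h₀
  obtain ⟨Ψ', hΨ', -, h'⟩ := exists_cup_eq_unit hΘ hΘ₀
  have e : Ψ' = Ψ := by
    rw [← cup_unit_right hΨ'.1, ← h, ← cup_assoc (add_zero 0) (add_zero 0), h', cup_unit_left]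
  exact ⟨Θ, hΘ, h, e ▸ h'⟩

end Inverse

/-! ### Essential surjectivity -/

theorem H0.nonempty_iso {A : DGCat k} {X Y : A.Obj} {f : A.Hom X Y 0} {g : A.Hom Y X 0}
    (hf : f ∈ A.cocycles X Y 0) (hg : g ∈ A.cocycles Y X 0)
    (hgf : A.comp (add_zero 0) g f = A.one X) (hfg : A.comp (add_zero 0) f g = A.one Y) :
    Nonempty ((⟨X⟩ : H0 A) ≅ ⟨Y⟩) :=
  ⟨{ hom := Submodule.Quotient.mk ⟨f, hf⟩
     inv := Submodule.Quotient.mk ⟨g, hg⟩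
     hom_inv_id := congrArg Submodule.Quotient.mk (Subtype.ext hgf)
     inv_hom_id := congrArg Submodule.Quotient.mk (Subtype.ext hfg) }⟩

theorem mem_cocycles_of_inverse {A : DGCat k} {X Y : A.Obj} {f : A.Hom X Y 0} {g : A.Hom Y X 0}
    (hf : f ∈ A.cocycles X Y 0) (hgf : A.comp (add_zero 0) g f = A.one X)
    (hfg : A.comp (add_zero 0) f g = A.one Y) : g ∈ A.cocycles Y X 0 := by
  have hf' : A.d 0 (0 + 1) rfl f = 0 := hf
  have h := A.leibniz (add_zero 0) rfl rfl rfl (add_zero (0 + 1)) (zero_add (0 + 1)) g f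
  rw [hgf, A.d_one, hf', map_zero, smul_zero, add_zero] at h
  have h' := A.assoc (add_zero (0 + 1)) (add_zero (0 + 1)) (add_zero 0) (add_zero (0 + 1))
    (A.d 0 (0 + 1) rfl g) f g
  rw [← h, hfg, map_zero, LinearMap.zero_apply, A.comp_one] at h'
  exact h'.symm

variable (C D) in
theorem mapCohomology_cohInclusion_bijective (F G : (cohDG C D).Obj) (n : ℤ) :
    Function.Bijective ((cohInclusion C D).mapCohomology F G n) := by
  constructor
  · refine (injective_iff_map_eq_zero _).2 fun x hx => ?_
    obtain ⟨f, rfl⟩ := Submodule.Quotient.mk_surjective _ x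
    exact (Submodule.Quotient.mk_eq_zero _).2 ((Submodule.Quotient.mk_eq_zero _).1 hx)
  · intro y
    obtain ⟨f, rfl⟩ := Submodule.Quotient.mk_surjective _ y
    exact ⟨Submodule.Quotient.mk f, rfl⟩

/-- An `A∞`-functor is isomorphic in `H⁰` to the dg functor of any section of the projection of its
rectification. -/
theorem RectificationSection.nonempty_iso {F : AInfFunctor C D} (s : RectificationSection F) :
    Nonempty ((⟨F⟩ : H0 (cohAInf C D)) ≅ ⟨s.functor.toAInf⟩) := by
  obtain ⟨Θ, hΘ, h₁, h₂⟩ := exists_cup_inverse s.transformation_mem s.transformation_nil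
  have hf : (⟨s.transformation, s.transformation_mem⟩ : (cohAInf C D).Hom F s.functor.toAInf 0) ∈
      (cohAInf C D).cocycles F s.functor.toAInf 0 := Subtype.ext s.twistedDiff_transformation
  have hgf := Subtype.ext (a1 := (cohAInf C D).comp (X := F) (Y := s.functor.toAInf) (Z := F)
    (add_zero 0) ⟨Θ, hΘ⟩ ⟨s.transformation, s.transformation_mem⟩) (a2 := (cohAInf C D).one F) h₁
  have hfg := Subtype.ext (a1 := (cohAInf C D).comp (X := s.functor.toAInf) (Y := F)
    (Z := s.functor.toAInf) (add_zero 0) ⟨s.transformation, s.transformation_mem⟩ ⟨Θ, hΘ⟩)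
    (a2 := (cohAInf C D).one s.functor.toAInf) h₂
  exact H0.nonempty_iso hf (mem_cocycles_of_inverse hf hgf hfg) hgf hfg

end DGCat

theorem mainTheorem6 (k : Type u) [Field k] (C D : DGCat k) (hC : C.IsCofibrant) :
    (DGCat.cohInclusion C D).IsQuasiEquivalence := by
  have h := DGCat.mapCohomology_cohInclusion_bijective C D
  obtain ⟨h₁, h₂⟩ := (DGCat.cohInclusion C D).fullyFaithful_mapH0 h
  have h₃ : (DGCat.cohInclusion C D).mapH0.EssSurj := ⟨fun F => by
    obtain ⟨s⟩ := hC.nonempty_rectificationSection F.obj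
    obtain ⟨e⟩ := s.nonempty_iso
    exact ⟨⟨s.functor⟩, ⟨e.symm⟩⟩⟩
  exact ⟨h, {}⟩
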